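/- **Setting.** Among $n$ nodes, $(1-q)n\ge 1$ are honest and $qn\ge 0$ are adversarial. The protocol has parameters $k,m_0,\ell\in\mathbb N$ with $m_0,\ell\ge 1$, and reals $\tfrac12<a\le b<1$, $\beta\in(0,\tfrac12)$. Every honest node holds an initial bit (its opinion). In each round $m=1,2,\dots$ every honest node sends $k$ queries to independently and uniformly chosen nodes (repetitions and self-queries allowed); honest nodes answer with their current opinion. Then a common threshold $X_m$ is revealed, independent of everything that happened before, with $X_1\sim U[a,b]$ and $X_m\sim U[\beta,1-\beta]$ for $m\ge2$; each honest node whose opinion is not yet final adopts opinion $1$ if the proportion of $1$-answers it received is at least $X_m$, and opinion $0$ otherwise. An opinion that a node has had in $\ell$ consecutive rounds, all with numbers at least $m_0+1$, becomes final for that node and is never changed. The adversary knows everything that has happened so far, but not the present and future thresholds. A *berserk* adversary may answer all queries arbitrarily; for a *cautious* one each adversarial node gives the same answer to all queries of a round, chosen before the round starts. Let $H_i$ be the event that all honest nodes eventually reach the final opinion $i$, and $\mathcal N$ the number of rounds until all honest nodes have a final opinion. Let $q<\beta<\frac12$, put $\epsilon=e^{-\frac12k(\beta-q)^2}$ and assume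 that $\varphi=\frac{\beta-q}{2(1-q)}-\epsilon>0$. For an integer $u\ge0$ let $$W(n,k,m_0,\ell,u)=(1-q)n\Big(\big(1-(1-\epsilon)^\ell\big)^u+\Big(\frac{\epsilon}{1-\epsilon}\Big)^{\ell-1}\Big)+(m_0+\ell u)\,e^{-2(1-q)n\varphi^2},$$ $$\psi_{cau}(n,k)=2e^{-\frac18n\frac{(\beta-q)^2}{4(1-q)}}+\frac{\sqrt{2k^{-1}\ln\frac{4(1-q)}{\beta-q}}}{1-2\beta},\qquad \psi_{ber}(n,k)=2e^{-\frac18n\frac{(\beta-q)^2}{4(1-q)}}+\frac{q+\sqrt{2k^{-1}\ln\frac{4(1-q)}{\beta-q}}}{1-2\beta}.$$ **Theorem 1.** (i) For any strategy of a cautious adversary, $$\mathbb P\big[(H_0\cup H_1)\cap\{\mathcal N\le m_0+\ell u\}\big]\ \ge\ 1-W(n,k,m_0,\ell,u)-\psi_{cau}(n,k)^{m_0-1}.$$ (ii) For any strategy of a berserk adversary, $$\mathbb P\big[(H_0\cup H_1)\cap\{\mathcal N\le m_0+\ell u\}\big]\ \ge\ 1-W(n,k,m_0,\ell,u)-\psi_{ber}(n,k)^{m_0-1}.$$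 If moreover $b-a\ge 1-2\beta$ (the first threshold is at least as spread out as the later ones), then the exponent $m_0-1$ can be replaced by $m_0$ in both (i) and (ii). -/

import Mathlib

open MeasureTheory ProbabilityTheory

noncomputable section

/-- Parameters of the system and of the protocol (pure data). -/
structure Params where
  /-- number of honest nodes -/
  honest : ℕ
  /-- number of adversarial nodes -/
  adv : ℕ
  /-- number of queries that each honest node makes in a round -/
  k : ℕ
  /-- length of the cooling-off period -/
  m₀ : ℕ
  /-- number of consecutive rounds with the same opinion that makes it final -/
  ℓ : ℕ
  /-- limits of the threshold in the first round -/
  a : ℝ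
  b : ℝ
  /-- the threshold of a later round is uniform on `[β, 1 - β]` -/
  β : ℝ

namespace Params

variable (P : Params)

/-- The nodes: honest ones on the left, adversarial ones on the right. -/
abbrev Node : Type := Fin P.honest ⊕ Fin P.adv

/-- Total number of nodes. -/
def n : ℕ := P.honest + P.adv

/-- Proportion of adversarial nodes (so that `(1 - q) n` is the number of honest nodes). -/
def q : ℝ := (P.adv : ℝ) / (P.n : ℝ)

/-- `exp (-k (β - q)² / 2)` -/
def err : ℝ := Real.exp (-(1 / 2) * P.k * (P.β - P.q) ^ 2)

/-- `φ_{β,q,k}` -/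
def phi : ℝ := (P.β - P.q) / (2 * (1 - P.q)) - P.err

/-- `W(n, k, m₀, ℓ, u)` -/
def W (u : ℕ) : ℝ :=
  (1 - P.q) * P.n *
      ((1 - (1 - P.err) ^ P.ℓ) ^ u + (P.err / (1 - P.err)) ^ (P.ℓ - 1)) +
    (P.m₀ + P.ℓ * u) * Real.exp (-2 * (1 - P.q) * P.n * P.phi ^ 2)

/-- `√(2 k⁻¹ ln (4 (1 - q) / (β - q)))` -/
def width : ℝ :=
  Real.sqrt (2 * (P.k : ℝ)⁻¹ * Real.log (4 * (1 - P.q) / (P.β - P.q)))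

/-- `ψ_cau(n, k)` -/
def psiCau : ℝ :=
  2 * Real.exp (-(1 / 8) * P.n * ((P.β - P.q) ^ 2 / (4 * (1 - P.q)))) +
    (1 - 2 * P.β)⁻¹ * P.width

/-- `ψ_ber(n, k)` -/
def psiBer : ℝ :=
  2 * Real.exp (-(1 / 8) * P.n * ((P.β - P.q) ^ 2 / (4 * (1 - P.q)))) +
    (P.q + P.width) / (1 - 2 * P.β)

/-- Lower limit of the random threshold in round `m ≥ 1`. -/
def lower (m : ℕ) : ℝ := if m = 1 then P.a else P.β

/-- Upper limit of the random threshold in round `m ≥ 1`. -/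
def upper (m : ℕ) : ℝ := if m = 1 then P.b else 1 - P.β

end Params

/-- The uniform distribution on `[s, r]` for `s ≤ r`, as an affine image of Lebesgue measure on
the unit interval; for `s = r` it is the point mass at `s`. -/
def uniformLaw (s r : ℝ) : Measure ℝ :=
  (volume.restrict (Set.Icc (0 : ℝ) 1)).map (fun t => s + (r - s) * t)

/-- A trajectory `x 0, x 1, …` of opinions of one node (`x m` being the opinion after round `m`)
has made the opinion `v` final by the end of round `m`: there were `ℓ` consecutive rounds
`s + 1, …, s + ℓ`, all after the cooling-off period `1, …, m₀` and none later than `m`, in which the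
node had opinion `v`. -/
def FinalBy (m₀ ℓ : ℕ) (x : ℕ → Bool) (m : ℕ) (v : Bool) : Prop :=
  ∃ s, m₀ ≤ s ∧ s + ℓ ≤ m ∧ ∀ t, s < t → t ≤ s + ℓ → x t = v

/-- A run of the protocol on the probability space `(Ω, μ)` against an arbitrary (berserk)
adversary. Rounds are numbered `1, 2, …`; round `m + 1` goes from the opinions `opinion m` to the
opinions `opinion (m + 1)`. Apart from `opinion`, data with round number `0` play no role.

The adversary is omniscient but not prescient: `info m` is everything that has happened up to the
end of round `m` (it may contain private randomness of the adversary), `during (m + 1)` is everything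
that has happened before the threshold of round `m + 1` is revealed. -/
structure Execution (P : Params) {Ω : Type*} [mΩ : MeasurableSpace Ω] (μ : Measure Ω) where
  info : ℕ → MeasurableSpace Ω
  during : ℕ → MeasurableSpace Ω
  info_le : ∀ m, info m ≤ mΩ
  info_le_during : ∀ m, info m ≤ during (m + 1)
  during_le_info : ∀ m, during (m + 1) ≤ info (m + 1)
  /-- `query m ω j i` is the node to which honest node `j` sends its `i`-th query of round `m` -/
  query : ℕ → Ω → Fin P.honest → Fin P.k → P.Node
  /-- `threshold m ω` is the common random threshold of round `m` -/
  threshold : ℕ → Ω → ℝ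
  /-- `reply m ω e j i` is what adversarial node `e` answers, when asked, to the `i`-th query of
  honest node `j` in round `m` -/
  reply : ℕ → Ω → Fin P.adv → Fin P.honest → Fin P.k → Bool
  /-- `opinion m ω j` is the opinion of honest node `j` after round `m` (initially, for `m = 0`) -/
  opinion : ℕ → Ω → Fin P.honest → Bool
  /-- the initial opinions are arbitrary -/
  measurable_initial : Measurable[info 0] (opinion 0)
  /-- the queries of a round are independent and uniform among all nodes (repetitions and
  self-queries allowed), and independent of the past -/
  measurable_query : ∀ m, Measurable[during (m + 1)] (query (m + 1))
  uniform_query : ∀ m j i v, μ.real {ω | query (m + 1) ω j i = v} = 1 / (P.n : ℝ)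
  indep_queries : ∀ m,
    iIndepFun (fun (p : Fin P.honest × Fin P.k) (ω : Ω) => query (m + 1) ω p.1 p.2) μ
  query_indep_info : ∀ m,
    Indep (MeasurableSpace.comap (query (m + 1)) inferInstance) (info m) μ
  /-- the adversary may use everything except the thresholds of the present and later rounds -/
  measurable_reply : ∀ m, Measurable[during (m + 1)] (reply (m + 1))
  /-- the threshold is uniform and independent of all that happened before it is revealed -/
  measurable_threshold : ∀ m, Measurable[info (m + 1)] (threshold (m + 1))
  law_threshold : ∀ m,
    μ.map (threshold (m + 1)) = uniformLaw (P.lower (m + 1)) (P.upper (m + 1))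
  threshold_indep_during : ∀ m,
    Indep (MeasurableSpace.comap (threshold (m + 1)) inferInstance) (during (m + 1)) μ
  /-- honest nodes follow the protocol: a node whose opinion is final keeps it; any other node `j`
  adopts opinion `1` if the proportion of `1`-responses to its `k` queries is at least the threshold,
  and opinion `0` otherwise -/
  opinion_final : ∀ m ω j, (∃ v, FinalBy P.m₀ P.ℓ (fun t => opinion t ω j) m v) →
    opinion (m + 1) ω j = opinion m ω j
  opinion_step : ∀ m ω j, (¬ ∃ v, FinalBy P.m₀ P.ℓ (fun t => opinion t ω j) m v) →
    (opinion (m + 1) ω j = true ↔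
      threshold (m + 1) ω ≤ (P.k : ℝ)⁻¹ *
        (Finset.univ.filter (fun i : Fin P.k =>
          Sum.elim (fun j' => opinion m ω j') (fun e => reply (m + 1) ω e j i)
            (query (m + 1) ω j i) = true)).card)

namespace Execution

variable {P : Params} {Ω : Type*} [MeasurableSpace Ω] {μ : Measure Ω} (E : Execution P μ)

/-- The adversary is cautious: in each round every adversarial node gives the same answer to all
queries, and these answers are chosen before the round starts. -/
def IsCautious : Prop :=
  (∀ m, Measurable[E.info m] (E.reply (m + 1))) ∧
    ∀ m ω e j i j' i', E.reply (m + 1) ω e j i = E.reply (m + 1) ω e j' i'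

/-- The event `H_v` that all honest nodes eventually reach the final opinion `v`. -/
def H (v : Bool) : Set Ω :=
  {ω | ∀ j, ∃ m, FinalBy P.m₀ P.ℓ (fun t => E.opinion t ω j) m v}

/-- The number of rounds until all honest nodes have a final opinion (`⊤` if this never happens). -/
def rounds (ω : Ω) : ℕ∞ :=
  ⨅ m ∈ {m : ℕ | ∀ j, ∃ v, FinalBy P.m₀ P.ℓ (fun t => E.opinion t ω j) m v}, (m : ℕ∞)

/-- All honest nodes agree on the same final opinion, and have it within `m₀ + ℓ u` rounds. -/
def consensusBy (u : ℕ) : Set Ω :=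
  (E.H false ∪ E.H true) ∩ {ω | E.rounds ω ≤ ((P.m₀ + P.ℓ * u : ℕ) : ℕ∞)}

end Execution

end

/-! Write `N` for the number of honest nodes, `ε` for `P.err` and call `(β - q) / (2 (1 - q))` the
tolerance. The configuration of opinions *leans* towards `v` if the proportion of honest nodes
with another opinion is within the tolerance, so that `φ` is the tolerance minus `ε`, and since `β
< 1/2` it leans towards at most one opinion. Every probability is bounded conditionally on the
past, in the integrated form `CondProbLE`; such a bound follows from an unconditional one for
every frozen value of the past (`CondProbLE.of_freeze`).

*Before the lean.* Up to round `m₀` no opinion is final. At the start of a round there are sets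
`BL ⊆ BU` of nodes such that queries to `BL` are answered by `1` and those to the complement of
`BU` by `0`; `BU` exceeds `BL` by a proportion `0` (cautious adversary) or `q` (berserk adversary)
of the nodes. If the threshold has distance at least `width / 2` from the interval between these
two proportions, then a node adopts the opinion on the wrong side of the threshold only when its
sample deviates by `width / 2` from the mean, which has probability at most half the tolerance;
Hoeffding's inequality for the number of such nodes shows that the system then leans, except on an
event of small probability. Hence a round leaves the system undecided with conditional probability
at most `ψ` (`Execution.condProbLE_undecided`), and `m₀ - 1` rounds (or `m₀`, if the first
threshold is spread out enough) do so with probability at most `ψ ^ (m₀ - 1)` (or `ψ ^ m₀`).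

*After the lean.* If the system leans towards `v`, a node that is not final adopts the opposite
opinion only if it is *misled*: at least a proportion `β` of its queries goes to adversarial nodes
or dissenters, whose proportion is at most `(β + q) / 2`. This does not depend on the answers of
the adversary, has conditional probability at most `ε`, and is independent among the nodes; so
except with probability `exp (-2 N φ²)` per round few nodes are misled and the lean persists,
provided that no node has made the opposite opinion final.

*Finality.* For a single node, the rounds after `m₀` are trials that fail when the node is misled.
If one of `u` blocks of `ℓ` trials has no failure, the node makes `v` final. For the opposite
opinion to become final for it, a run of `ℓ` failures has to precede every run of `ℓ` successes,
which has probability at most `(ε / (1 - ε)) ^ (ℓ - 1)` by a supermartingale argument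
(`measureReal_raceLost_le`). A union bound over nodes and rounds gives `W`. That these exceptional
events are the only obstacles is a deterministic statement about trajectories,
`Execution.Steady.mem_consensusBy`. -/

noncomputable section

/-! ### Hoeffding's inequality for independent events -/

section Concentration

variable {Ω : Type*} [mΩ : MeasurableSpace Ω] {μ : Measure Ω}

/-- In an independent family indexed by pairs, the rows are independent. -/
theorem iIndepFun_curry {ι κ S : Type*} [MeasurableSpace S] {X : ι → κ → Ω → S}
    (hX : ∀ i j, Measurable (X i j))
    (h : iIndepFun (fun (p : ι × κ) ω => X p.1 p.2 ω) μ) :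
    iIndepFun (fun i ω => (X i · ω)) μ := by
  have := h.isProbabilityMeasure
  have : ∀ i j, IsProbabilityMeasure (μ.map (X i j)) :=
    fun i j => Measure.isProbabilityMeasure_map (hX i j).aemeasurable
  have : ∀ i, IsProbabilityMeasure (μ.map fun ω => (X i · ω)) :=
    fun i => Measure.isProbabilityMeasure_map (Measurable.aemeasurable (by fun_prop))
  have h1 : ∀ i, μ.map (fun ω => (X i · ω)) = Measure.infinitePi fun j => μ.map (X i j) :=
    fun i => (iIndepFun_iff_map_fun_eq_infinitePi_map (by fun_prop)).1
      (h.precomp (g := fun j : κ => (i, j)) fun a b hab => (Prod.ext_iff.1 hab).2)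
  have h2 : iIndepFun (fun (p : (_ : ι) × κ) ω => X p.1 p.2 ω) μ :=
    h.precomp (g := Equiv.sigmaEquivProd ι κ) (Equiv.sigmaEquivProd ι κ).injective
  have hc : (MeasurableEquiv.piCurry fun (_ : ι) (_ : κ) => S) ∘
      (fun ω (p : (_ : ι) × κ) => X p.1 p.2 ω) = fun ω i j => X i j ω := by
    ext; simp [Sigma.curry]
  rw [iIndepFun_iff_map_fun_eq_infinitePi_map (by fun_prop)] at h2 ⊢
  simp_rw [h1]
  rw [← Measure.infinitePi_map_piCurry (fun i j => μ.map (X i j)), ← h2,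
    Measure.map_map (by fun_prop) (by fun_prop), hc]

/-- Hoeffding's inequality for independent events `{X i ∈ B}`: if each has probability at most
`p`, the proportion of events that occur is at least `p + δ` with probability at most `exp (-2 |ι|
δ²)`. -/
theorem measureReal_card_ge_le [IsProbabilityMeasure μ] {ι S : Type*} [Fintype ι]
    [MeasurableSpace S] {X : ι → Ω → S} (hX : ∀ i, Measurable (X i)) (h : iIndepFun X μ)
    {B : Set S} (hB : MeasurableSet B) [∀ ω, DecidablePred fun i => X i ω ∈ B]
    {p δ : ℝ} (hδ : 0 ≤ δ) (hp : ∀ i, μ.real {ω | X i ω ∈ B} ≤ p) :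
    μ.real {ω | (Fintype.card ι : ℝ) * (p + δ) ≤ (Finset.univ.filter fun i => X i ω ∈ B).card} ≤
      Real.exp (-2 * Fintype.card ι * δ ^ 2) := by
  classical
  set N : ℝ := (Fintype.card ι : ℝ) with hN
  set g : S → ℝ := B.indicator 1 with hg
  have hgm : Measurable g := measurable_one.indicator hB
  have hmeas : ∀ i, Measurable fun ω => g (X i ω) := fun i => hgm.comp (hX i)
  have hint : ∀ i, ∫ ω, g (X i ω) ∂μ = μ.real {ω | X i ω ∈ B} := fun i => by
    have : (fun ω => g (X i ω)) = {ω | X i ω ∈ B}.indicator 1 := by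
      ext ω; simp [hg, Set.indicator]
    rw [this]
    exact integral_indicator_one (hX i hB)
  set Y : ι → Ω → ℝ := fun i ω => g (X i ω) - ∫ x, g (X i x) ∂μ with hY
  have hYi : iIndepFun Y μ :=
    h.comp (fun i s => g s - ∫ x, g (X i x) ∂μ) fun i => hgm.sub_const _
  have hsub : ∀ i ∈ (Finset.univ : Finset ι),
      HasSubgaussianMGF (Y i) ((‖(1 : ℝ) - 0‖₊ / 2) ^ 2) μ := fun i _ =>
    hasSubgaussianMGF_of_mem_Icc (hmeas i).aemeasurable <| ae_of_all _ fun ω => by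
      by_cases hh : X i ω ∈ B <;> simp [hg, hh]
  have key := HasSubgaussianMGF.measure_sum_ge_le_of_iIndepFun hYi hsub
    (ε := N * δ) (by positivity)
  refine (measureReal_mono ?_).trans (key.trans (Real.exp_le_exp.2 ?_))
  · intro ω hω
    simp only [Set.mem_ofPred_eq] at hω ⊢
    have e1 : ∑ i, g (X i ω) = ((Finset.univ.filter fun i => X i ω ∈ B).card : ℝ) := by
      rw [Finset.card_filter]
      push_cast
      exact Finset.sum_congr rfl fun i _ => by
        by_cases hh : X i ω ∈ B <;> simp [hg, hh]
    have e2 : ∑ i, ∫ x, g (X i x) ∂μ ≤ N * p := by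
      calc _ ≤ ∑ _i : ι, p := Finset.sum_le_sum fun i _ => (hint i).trans_le (hp i)
        _ = N * p := by simp [hN]
    simp only [hY, Finset.sum_sub_distrib, e1]
    linarith
  · have e3 : ((∑ _i : ι, (‖(1 : ℝ) - 0‖₊ / 2) ^ 2 : NNReal) : ℝ) = N / 4 := by
      simp [hN]; ring
    rw [e3]
    rcases eq_or_lt_of_le (show 0 ≤ N by positivity) with h0 | h0
    · simp [← h0]
    · apply le_of_eq; field_simp; norm_num

end Concentration

/-! ### Bounds for conditional probabilities -/

section Conditional

variable {Ω : Type*}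

/-- The conditional probability of the event `S` given the information `m` is at most `c`, in
integrated form. -/
def CondProbLE {mΩ : MeasurableSpace Ω} (μ : Measure Ω) (m : MeasurableSpace Ω)
    (S : Set Ω) (c : ℝ) : Prop :=
  ∀ A, MeasurableSet[m] A → μ.real (A ∩ S) ≤ c * μ.real A

variable {mΩ : MeasurableSpace Ω} {μ : Measure Ω}

namespace CondProbLE

variable {m : MeasurableSpace Ω} {S T : Set Ω} {c d : ℝ}

theorem le_const (h : CondProbLE μ m S c) (hcd : c ≤ d) : CondProbLE μ m S d :=
  fun A hA => (h A hA).trans (mul_le_mul_of_nonneg_right hcd measureReal_nonneg)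

theorem union (hS : CondProbLE μ m S c) (hT : CondProbLE μ m T d) :
    CondProbLE μ m (S ∪ T) (c + d) := fun A hA => by
  rw [Set.inter_union_distrib_left, add_mul]
  exact (measureReal_union_le _ _).trans (add_le_add (hS A hA) (hT A hA))

variable [IsProbabilityMeasure μ]

theorem measureReal_le (h : CondProbLE μ m S c) : μ.real S ≤ c := by
  simpa using h Set.univ MeasurableSet.univ

theorem mono_ae (h : CondProbLE μ m S c) (hST : ∀ᵐ ω ∂μ, ω ∈ T → ω ∈ S) :
    CondProbLE μ m T c := fun A hA =>
  le_trans (ENNReal.toReal_mono (measure_ne_top _ _) (measure_mono_ae (by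
    filter_upwards [hST] with ω hω h using ⟨h.1, hω h.2⟩))) (h A hA)

theorem mono (h : CondProbLE μ m S c) (hST : T ⊆ S) : CondProbLE μ m T c :=
  h.mono_ae (ae_of_all _ fun _ hω => hST hω)

/-- An event that depends on a finite-valued random element `Z` known at the time and on fresh
randomness has small conditional probability as soon as it has small probability for every
frozen value of `Z`. -/
theorem of_freeze {m' : MeasurableSpace Ω} (hm : m ≤ mΩ) (hind : Indep m' m μ)
    {κ : Type*} [Finite κ] {Z : Ω → κ} (hZ : ∀ z, MeasurableSet[m] {ω | Z ω = z})
    {R : κ → Set Ω} (hR : ∀ z, MeasurableSet[m'] (R z)) (hc : ∀ z, μ.real (R z) ≤ c) :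
    CondProbLE μ m {ω | ω ∈ R (Z ω)} c := fun A hA => by
  classical
  have := Fintype.ofFinite κ
  have hAZ : ∀ z, MeasurableSet[m] (A ∩ {ω | Z ω = z}) := fun z =>
    MeasurableSet.inter hA (hZ z)
  have hsum : ∑ z, μ.real (A ∩ {ω | Z ω = z}) = μ.real A := by
    rw [← measureReal_iUnion_fintype]
    · congr 1; ext ω; simp
    · intro z w hzw
      refine Set.disjoint_left.2 fun ω h1 h2 => hzw (h1.2.symm.trans h2.2)
    · exact fun z => hm _ (hAZ z)
  calc μ.real (A ∩ {ω | ω ∈ R (Z ω)})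
      ≤ μ.real (⋃ z, R z ∩ (A ∩ {ω | Z ω = z})) := by
        refine measureReal_mono fun ω hω => Set.mem_iUnion.2 ⟨Z ω, hω.2, hω.1, rfl⟩
    _ ≤ ∑ z, μ.real (R z ∩ (A ∩ {ω | Z ω = z})) := measureReal_iUnion_fintype_le _
    _ = ∑ z, μ.real (R z) * μ.real (A ∩ {ω | Z ω = z}) := by
        refine Finset.sum_congr rfl fun z _ => ?_
        simp only [Measure.real, (Indep_iff m' m μ).1 hind _ _ (hR z) (hAZ z), ENNReal.toReal_mul]
    _ ≤ ∑ z, c * μ.real (A ∩ {ω | Z ω = z}) :=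
        Finset.sum_le_sum fun z _ => mul_le_mul_of_nonneg_right (hc z) measureReal_nonneg
    _ = c * μ.real A := by rw [← Finset.mul_sum, hsum]

/-- The one-step estimate: if `S` has conditional probability at most `c`, a continuation that costs
`v₁` on `S` and a smaller `v₀` off `S` costs at most `c v₁ + (1 - c) v₀`. -/
theorem measureReal_step_le (h : CondProbLE μ m S c) (hS : MeasurableSet[mΩ] S)
    {A T₁ T₀ : Set Ω} (hA : MeasurableSet[m] A) {v₁ v₀ : ℝ}
    (h₁ : μ.real (A ∩ S ∩ T₁) ≤ v₁ * μ.real (A ∩ S))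
    (h₀ : μ.real (A ∩ Sᶜ ∩ T₀) ≤ v₀ * μ.real (A ∩ Sᶜ)) (hv : v₀ ≤ v₁) :
    μ.real (A ∩ (S ∩ T₁ ∪ Sᶜ ∩ T₀)) ≤ (c * v₁ + (1 - c) * v₀) * μ.real A := by
  have hsplit : μ.real (A ∩ S) + μ.real (A ∩ Sᶜ) = μ.real A := by
    have := measureReal_inter_add_sdiff (μ := μ) (s := A) hS
    rwa [Set.sdiff_eq] at this
  have e : A ∩ (S ∩ T₁ ∪ Sᶜ ∩ T₀) = A ∩ S ∩ T₁ ∪ A ∩ Sᶜ ∩ T₀ := by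
    rw [Set.inter_union_distrib_left, Set.inter_assoc, Set.inter_assoc]
  rw [e]
  refine (measureReal_union_le _ _).trans ((add_le_add h₁ h₀).trans ?_)
  have := mul_le_mul_of_nonneg_left (h A hA) (sub_nonneg.2 hv)
  rw [← hsplit] at this ⊢
  linarith

end CondProbLE

section Filtration

variable [IsProbabilityMeasure μ] {ℱ : ℕ → MeasurableSpace Ω} {S : ℕ → Set Ω} {c : ℝ}

/-- If in each round an event has conditional probability at most `c`, it occurs in all of `n`
consecutive rounds with conditional probability at most `cⁿ`. -/
theorem measureReal_inter_forall_le (hS : ∀ t, MeasurableSet[ℱ (t + 1)] (S t))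
    (hmono : Monotone ℱ) (hc : 0 ≤ c)
    (h : ∀ t, CondProbLE μ (ℱ t) (S t) c) (n t : ℕ) {A : Set Ω} (hA : MeasurableSet[ℱ t] A) :
    μ.real (A ∩ {ω | ∀ i < n, ω ∈ S (t + i)}) ≤ c ^ n * μ.real A := by
  induction n generalizing t A with
  | zero => simp
  | succ n ih =>
    have e : A ∩ {ω | ∀ i < n + 1, ω ∈ S (t + i)} ⊆
        A ∩ S t ∩ {ω | ∀ i < n, ω ∈ S (t + 1 + i)} := fun ω hω =>
      ⟨⟨hω.1, by simpa using hω.2 0 (by omega)⟩, fun i hi => by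
        simpa [add_assoc, add_comm 1 i] using hω.2 (i + 1) (by omega)⟩
    refine (measureReal_mono e).trans
      ((ih (t + 1) (MeasurableSet.inter (hmono (Nat.le_succ t) _ hA) (hS t))).trans ?_)
    rw [pow_succ, mul_assoc]
    exact mul_le_mul_of_nonneg_left (h t A hA) (by positivity)

/-- Within `n` rounds an event of conditional probability at most `c` per round occurs at least once
with conditional probability at most `1 - (1 - c)ⁿ`. -/
theorem condProbLE_exists (hS : ∀ t, MeasurableSet[ℱ (t + 1)] (S t))
    (hmono : Monotone ℱ) (hle : ∀ t, ℱ t ≤ mΩ) (hc : c ≤ 1)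
    (h : ∀ t, CondProbLE μ (ℱ t) (S t) c) (n t : ℕ) :
    CondProbLE μ (ℱ t) {ω | ∃ i < n, ω ∈ S (t + i)} (1 - (1 - c) ^ n) := by
  induction n generalizing t with
  | zero => intro A _; simp
  | succ n ih =>
    intro A hA
    have hA' := hmono (Nat.le_succ t) _ hA
    have e : A ∩ {ω | ∃ i < n + 1, ω ∈ S (t + i)} ⊆
        A ∩ (S t ∩ Set.univ ∪ (S t)ᶜ ∩ {ω | ∃ i < n, ω ∈ S (t + 1 + i)}) := by
      rintro ω ⟨hωA, i, hi, hω⟩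
      refine ⟨hωA, ?_⟩
      by_cases hh : ω ∈ S t
      · exact Or.inl ⟨hh, trivial⟩
      · refine Or.inr ⟨hh, ?_⟩
        rcases i with _ | i
        · exact absurd (by simpa using hω) hh
        · exact ⟨i, by omega, by simpa [add_assoc, add_comm 1 i] using hω⟩
    have hp : 0 ≤ (1 - c) ^ n := pow_nonneg (by linarith) n
    refine (measureReal_mono e).trans ?_
    have := (h t).measureReal_step_le (hle _ _ (hS t)) hA (T₁ := Set.univ) (v₁ := 1)
      (by simp) (ih (t + 1) _ (MeasurableSet.inter hA' (hS t).compl)) (by linarith)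
    refine this.trans (le_of_eq ?_)
    ring

end Filtration
end Conditional

/-! ### The race between runs of failures and runs of successes -/

section RunRace

/-- The race between runs of failures and runs of successes in the binary sequence `x` (`x t` means
that trial `t` is a failure) is lost within the next `n` trials `t, t + 1, …`, that is, a run of `ℓ`
failures is completed before a run of `ℓ` successes. The race is observed when the trials before `t`
end with a run of `r` failures and a run of `r'` successes, one of `r` and `r'` being `0`. -/
def RaceLost (ℓ : ℕ) (x : ℕ → Prop) : ℕ → ℕ → ℕ → ℕ → Prop
  | 0, _, r, _ => ℓ ≤ r
  | n + 1, t, r, r' => ℓ ≤ r ∨ r' < ℓ ∧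
      (x t ∧ RaceLost ℓ x n (t + 1) (r + 1) 0 ∨ ¬ x t ∧ RaceLost ℓ x n (t + 1) 0 (r' + 1))

/-- If the `ℓ` trials before `e` are failures and no run of `ℓ` successes precedes them, then the
race is lost. Of the runs `r` and `r'` that the trials before `t` end with, `r` has to be an upper
bound for the final run of failures and `r'` a lower bound for that of successes. -/
theorem raceLost_of_run {ℓ : ℕ} {x : ℕ → Prop} {e : ℕ} (hℓ : 1 ≤ ℓ) (he : ℓ ≤ e)
    (hrun : ∀ i, e ≤ i + ℓ → i < e → x i)
    (hno : ∀ s, s + 2 * ℓ ≤ e → ∃ i, s ≤ i ∧ i < s + ℓ ∧ x i) (n t r r' : ℕ)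
    (hte : t ≤ e) (hen : e ≤ t + n)
    (hr : ∀ s ≤ t, (∀ i, s ≤ i → i < t → x i) → t ≤ s + r)
    (hr' : r' ≤ t ∧ ∀ i < t, t ≤ i + r' → ¬ x i) :
    RaceLost ℓ x n t r r' := by
  have hend : t = e → ℓ ≤ r := fun h => by
    have := hr (e - ℓ) (by omega) fun i h1 h2 => hrun i (by omega) (by omega)
    omega
  induction n generalizing t r r' with
  | zero => exact hend (by omega)
  | succ n ih =>
    by_cases ht : t = e
    · exact Or.inl (hend ht)
    refine Or.inr ⟨?_, ?_⟩
    · by_contra hcon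
      push Not at hcon
      obtain ⟨hr1, hr2⟩ := hr'
      -- the last success seen precedes the final run of failures, hence so do all `ℓ` of them
      have h1 : ¬ e ≤ t - 1 + ℓ := fun h =>
        hr2 (t - 1) (by omega) (by omega) (hrun (t - 1) h (by omega))
      obtain ⟨i, hi1, hi2, hi3⟩ := hno (t - ℓ) (by omega)
      exact hr2 i (by omega) (by omega) hi3
    · by_cases hx : x t
      · have hr2 : ∀ s ≤ t + 1, (∀ i, s ≤ i → i < t + 1 → x i) → t + 1 ≤ s + (r + 1) := by
          intro s hs h
          rcases Nat.lt_or_ge t s with h1 | h1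
          · omega
          · have := hr s h1 fun i hi1 hi2 => h i hi1 (by omega)
            omega
        refine Or.inl ⟨hx, ih (t + 1) (r + 1) 0 (by omega) (by omega) hr2
          ⟨by omega, fun i hi hi2 => by omega⟩ fun h => ?_⟩
        have := hr2 (e - ℓ) (by omega) fun i h1 h2 => hrun i (by omega) (by omega)
        omega
      · have hr2 : ∀ s ≤ t + 1, (∀ i, s ≤ i → i < t + 1 → x i) → t + 1 ≤ s + 0 := by
          intro s hs h
          by_contra h1
          exact hx (h t (by omega) (by omega))
        refine Or.inr ⟨hx, ih (t + 1) 0 (r' + 1) (by omega) (by omega) hr2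
          ⟨by omega, fun i hi hi2 => ?_⟩ fun h => ?_⟩
        · rcases Nat.lt_or_ge i t with h1 | h1
          · exact hr'.2 i h1 (by omega)
          · rwa [show i = t by omega]
        · exact absurd (hrun t (by omega) (by omega)) hx

variable {Ω : Type*} {mΩ : MeasurableSpace Ω} {μ : Measure Ω} [IsProbabilityMeasure μ]
  {ℱ : ℕ → MeasurableSpace Ω} {S : ℕ → Set Ω} {p : ℝ}

/-- Ruin estimate for the race between runs, by backward induction. The bounds `p ^ (ℓ - r) + (1 -
p ^ (ℓ - r)) G` and `(1 - (1 - p) ^ (ℓ - r')) R`, with `R = (p / (1 - p)) ^ (ℓ - 1)` and `G` the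
second one for `r' = 1`, are superharmonic, and larger after a failure than after a success, so
that it is enough to have an upper bound for the conditional probability of a failure. -/
theorem measureReal_inter_raceLost_le (hS : ∀ t, MeasurableSet[ℱ (t + 1)] (S t))
    (hmono : Monotone ℱ) (hle : ∀ t, ℱ t ≤ mΩ) (hp : 0 ≤ p) (hp2 : p ≤ 1 / 2)
    (h : ∀ t, CondProbLE μ (ℱ t) (S t) p) {ℓ : ℕ} (hℓ : 1 ≤ ℓ) (n t : ℕ) :
    (∀ r, CondProbLE μ (ℱ t) {ω | RaceLost ℓ (fun t => ω ∈ S t) n t r 0}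
      (p ^ (ℓ - r) + (1 - p ^ (ℓ - r)) * ((1 - (1 - p) ^ (ℓ - 1)) * (p / (1 - p)) ^ (ℓ - 1)))) ∧
    ∀ r', CondProbLE μ (ℱ t) {ω | RaceLost ℓ (fun t => ω ∈ S t) n t 0 r'}
      ((1 - (1 - p) ^ (ℓ - r')) * (p / (1 - p)) ^ (ℓ - 1)) := by
  set R := (p / (1 - p)) ^ (ℓ - 1) with hR
  have hy0 : 0 < (1 - p) ^ (ℓ - 1) := pow_pos (by linarith) _
  have hpow : ∀ j, 0 ≤ (1 - p) ^ j ∧ (1 - p) ^ j ≤ 1 := fun j =>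
    ⟨pow_nonneg (by linarith) _, pow_le_one₀ (by linarith) (by linarith)⟩
  have hpow' : ∀ j, 0 ≤ p ^ j ∧ p ^ j ≤ 1 := fun j =>
    ⟨pow_nonneg hp _, pow_le_one₀ hp (by linarith)⟩
  have hR0 : 0 ≤ R := pow_nonneg (div_nonneg hp (by linarith)) _
  have hR1 : R ≤ 1 := pow_le_one₀ (div_nonneg hp (by linarith))
    ((div_le_one (by linarith)).2 (by linarith))
  have hx : p ^ (ℓ - 1) = R * (1 - p) ^ (ℓ - 1) := by
    rw [hR, div_pow, div_mul_cancel₀ _ hy0.ne']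
  set G := (1 - (1 - p) ^ (ℓ - 1)) * R with hG
  have hG0 : 0 ≤ G := mul_nonneg (by linarith [(hpow (ℓ - 1)).2]) hR0
  have hG1 : G ≤ 1 := mul_le_one₀ (by linarith [(hpow (ℓ - 1)).1]) hR0 hR1
  have hf0 : ∀ j, 0 ≤ p ^ j + (1 - p ^ j) * G := fun j =>
    add_nonneg (hpow' j).1 (mul_nonneg (by linarith [(hpow' j).2]) hG0)
  have hg0 : ∀ j, 0 ≤ (1 - (1 - p) ^ j) * R := fun j =>
    mul_nonneg (by linarith [(hpow j).2]) hR0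
  have hfR : p ^ (ℓ - 1) + (1 - p ^ (ℓ - 1)) * G ≤ R := by
    rw [hG, hx]
    have h1 := mul_nonneg (mul_nonneg hR0 hR0)
      (mul_nonneg hy0.le (sub_nonneg.2 (hpow (ℓ - 1)).2))
    nlinarith
  -- reduces an estimate for `n + 1` trials, before the race is decided, to the next trial
  have hstep : ∀ (t n r r' : ℕ) (v₁ v₀ : ℝ), r < ℓ → v₀ ≤ v₁ →
      CondProbLE μ (ℱ (t + 1)) {ω | RaceLost ℓ (fun t => ω ∈ S t) n (t + 1) (r + 1) 0} v₁ →
      CondProbLE μ (ℱ (t + 1)) {ω | RaceLost ℓ (fun t => ω ∈ S t) n (t + 1) 0 (r' + 1)} v₀ →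
      CondProbLE μ (ℱ t) {ω | RaceLost ℓ (fun t => ω ∈ S t) (n + 1) t r r'}
        (p * v₁ + (1 - p) * v₀) := by
    intro t n r r' v₁ v₀ hr hv h₁ h₀ A hA
    have hA' := hmono (Nat.le_succ t) _ hA
    refine le_trans (measureReal_mono ?_) ((h t).measureReal_step_le (hle _ _ (hS t)) hA
      (h₁ _ (MeasurableSet.inter hA' (hS t))) (h₀ _ (MeasurableSet.inter hA' (hS t).compl)) hv)
    rintro ω ⟨hωA, hω⟩
    rcases hω with hω | ⟨-, hω | hω⟩
    · omega
    · exact ⟨hωA, Or.inl hω⟩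
    · exact ⟨hωA, Or.inr hω⟩
  have htriv : ∀ (m : MeasurableSpace Ω) (T : Set Ω), CondProbLE μ m T 1 := fun m T A _ => by
    rw [one_mul]; exact measureReal_mono Set.inter_subset_left
  have hempty : ∀ (m : MeasurableSpace Ω) (T : Set Ω) (c : ℝ), 0 ≤ c → T = ∅ →
      CondProbLE μ m T c := fun m T c hc hT A _ => by
    rw [hT, Set.inter_empty, measureReal_empty]; exact mul_nonneg hc measureReal_nonneg
  have hfull : ∀ (n t r r' : ℕ), ℓ ≤ r →
      CondProbLE μ (ℱ t) {ω | RaceLost ℓ (fun t => ω ∈ S t) n t r r'}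
      (p ^ (ℓ - r) + (1 - p ^ (ℓ - r)) * G) := fun n t r r' hr => by
    rw [Nat.sub_eq_zero_of_le hr]
    simpa using htriv (ℱ t) _
  induction n generalizing t with
  | zero =>
    refine ⟨fun r => ?_, fun r' => hempty _ _ _ (hg0 _) ?_⟩
    · rcases Nat.lt_or_ge r ℓ with hr | hr
      · refine hempty _ _ _ (hf0 _) (Set.eq_empty_of_forall_notMem fun ω hω => ?_)
        exact absurd (show ℓ ≤ r from hω) (by omega)
      · exact hfull _ _ _ _ hr
    · exact Set.eq_empty_of_forall_notMem fun ω hω => absurd (show ℓ ≤ 0 from hω) (by omega)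
  | succ n ih =>
    obtain ⟨ih₁, ih₂⟩ := ih (t + 1)
    refine ⟨fun r => ?_, fun r' => ?_⟩
    · rcases Nat.lt_or_ge r ℓ with hr | hr
      · refine (hstep t n r 0 _ _ hr ?_ (ih₁ (r + 1)) (ih₂ 1)).le_const (le_of_eq ?_)
        · have := mul_nonneg (hpow' (ℓ - (r + 1))).1 (sub_nonneg.2 hG1)
          rw [← hG]; linarith
        · rw [show ℓ - r = ℓ - (r + 1) + 1 by omega, pow_succ, ← hG]; ring
      · exact hfull _ _ _ _ hr
    · rcases Nat.lt_or_ge r' ℓ with hr | hr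
      · refine (hstep t n 0 r' R _ (by omega) ?_ ((ih₁ 1).le_const hfR)
          (ih₂ (r' + 1))).le_const (le_of_eq ?_)
        · have := mul_nonneg (hpow (ℓ - (r' + 1))).1 hR0
          linarith
        · rw [show ℓ - r' = ℓ - (r' + 1) + 1 by omega, pow_succ]; ring
      · refine hempty _ _ _ (hg0 _) (Set.eq_empty_of_forall_notMem fun ω hω => ?_)
        rcases hω with hω | ⟨hω, -⟩ <;> omega

theorem measureReal_raceLost_le (hS : ∀ t, MeasurableSet[ℱ (t + 1)] (S t))
    (hmono : Monotone ℱ) (hle : ∀ t, ℱ t ≤ mΩ) (hp : 0 ≤ p) (hp2 : p ≤ 1 / 2)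
    (h : ∀ t, CondProbLE μ (ℱ t) (S t) p) {ℓ : ℕ} (hℓ : 1 ≤ ℓ) (n : ℕ) :
    μ.real {ω | RaceLost ℓ (fun t => ω ∈ S t) n 0 0 0} ≤ (p / (1 - p)) ^ (ℓ - 1) := by
  refine ((measureReal_inter_raceLost_le hS hmono hle hp hp2 h hℓ n 0).2 0).measureReal_le.trans ?_
  have h1 : 0 ≤ (1 - p) ^ (ℓ - 0) := pow_nonneg (by linarith) _
  exact mul_le_of_le_one_left (pow_nonneg (div_nonneg hp (by linarith)) _) (by linarith)

end RunRace

/-! ### Parameters and queries -/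

namespace Params

variable (P : Params)

/-- The assumptions on the parameters under which the protocol is analysed. -/
structure Admissible : Prop where
  honest_pos : 0 < P.honest
  ℓ_pos : 1 ≤ P.ℓ
  q_lt : P.q < P.β
  β_lt : P.β < 1 / 2
  phi_pos : 0 < P.phi

/-- The proportion `(β - q) / (2 (1 - q))` of dissenting honest nodes up to which the system counts
as leaning towards an opinion. -/
def tolerance : ℝ := (P.β - P.q) / (2 * (1 - P.q))

theorem q_nonneg : 0 ≤ P.q := div_nonneg (Nat.cast_nonneg _) (Nat.cast_nonneg _)

theorem phi_eq : P.phi = P.tolerance - P.err := rfl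

theorem err_pos : 0 < P.err := Real.exp_pos _

theorem width_nonneg : 0 ≤ P.width := Real.sqrt_nonneg _

variable {P}

namespace Admissible

theorem n_pos (h : P.Admissible) : 0 < (P.n : ℝ) := by
  have := h.honest_pos
  exact_mod_cast show 0 < P.honest + P.adv by omega

theorem q_mul_n (h : P.Admissible) : P.q * P.n = P.adv := div_mul_cancel₀ _ h.n_pos.ne'

theorem honest_eq (h : P.Admissible) : (P.honest : ℝ) = (1 - P.q) * P.n := by
  rw [sub_mul, h.q_mul_n, one_mul]
  simp [Params.n]

theorem q_lt_one (h : P.Admissible) : P.q < 1 := by linarith [h.q_lt, h.β_lt]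

theorem tolerance_pos (h : P.Admissible) : 0 < P.tolerance :=
  div_pos (by linarith [h.q_lt]) (by linarith [h.q_lt_one])

theorem tolerance_lt (h : P.Admissible) : P.tolerance < 1 / 2 := by
  rw [tolerance, div_lt_iff₀ (by linarith [h.q_lt_one])]
  linarith [h.β_lt]

theorem tolerance_mul (h : P.Admissible) : P.tolerance * (1 - P.q) = (P.β - P.q) / 2 := by
  have := h.q_lt_one
  have : 1 - P.q ≠ 0 := by linarith
  rw [tolerance]; field_simp

theorem err_lt (h : P.Admissible) : P.err < 1 / 2 := by
  linarith [h.phi_pos, P.phi_eq, h.tolerance_lt]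

theorem k_pos (h : P.Admissible) : 0 < P.k := by
  by_contra hk
  have : P.err = 1 := by simp [err, show P.k = 0 by omega]
  linarith [h.err_lt]

/-- `width / 2` is the deviation for which Hoeffding's bound for the `k` queries of a node is half
of the tolerance. -/
theorem exp_width (h : P.Admissible) :
    Real.exp (-2 * P.k * (P.width / 2) ^ 2) = P.tolerance / 2 := by
  have hk : (0 : ℝ) < P.k := Nat.cast_pos.2 h.k_pos
  have h1 : 0 < 1 - P.q := by linarith [h.q_lt_one]
  have h2 : 0 < P.β - P.q := by linarith [h.q_lt]
  have hlog : 0 ≤ Real.log (4 * (1 - P.q) / (P.β - P.q)) :=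
    Real.log_nonneg ((one_le_div h2).2 (by linarith [h.β_lt]))
  rw [div_pow, width, Real.sq_sqrt (by positivity),
    show -2 * (P.k : ℝ) * (2 * (P.k : ℝ)⁻¹ * Real.log (4 * (1 - P.q) / (P.β - P.q)) / 2 ^ 2)
      = - Real.log (4 * (1 - P.q) / (P.β - P.q)) by field_simp,
    Real.exp_neg, Real.exp_log (by positivity), tolerance, inv_div]
  field_simp
  norm_num

/-- Hoeffding's bound with deviation `tolerance / 2` is at most the (weaker) exponential term of
`ψ`. -/
theorem exp_tolerance_le (h : P.Admissible) :
    Real.exp (-2 * P.honest * (P.tolerance / 2) ^ 2) ≤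
      Real.exp (-(1 / 8) * P.n * ((P.β - P.q) ^ 2 / (4 * (1 - P.q)))) := by
  have h1 : 0 < 1 - P.q := by linarith [h.q_lt_one]
  have hn := h.n_pos
  refine Real.exp_le_exp.2 ?_
  have e : -2 * (P.honest : ℝ) * (P.tolerance / 2) ^ 2 =
      -(P.n * ((P.β - P.q) ^ 2 / (4 * (1 - P.q)))) / 2 := by
    rw [h.honest_eq, tolerance]; field_simp; ring
  have : 0 ≤ P.n * ((P.β - P.q) ^ 2 / (4 * (1 - P.q))) := by positivity
  rw [e]
  linarith

end Admissible

variable (P)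

/-- The number of queries of the honest node `j` that go to a node in `B`. -/
def hits (B : Finset P.Node) (Q : Fin P.honest → Fin P.k → P.Node) (j : Fin P.honest) : ℕ :=
  (Finset.univ.filter fun i => Q j i ∈ B).card

/-- The honest nodes that send at least a proportion `θ` of their queries to `B`. -/
def frequent (B : Finset P.Node) (θ : ℝ) (Q : Fin P.honest → Fin P.k → P.Node) :
    Finset (Fin P.honest) :=
  Finset.univ.filter fun j => P.k * θ ≤ P.hits B Q j

theorem mem_frequent {B : Finset P.Node} {θ : ℝ} {Q : Fin P.honest → Fin P.k → P.Node}
    {j : Fin P.honest} : j ∈ P.frequent B θ Q ↔ P.k * θ ≤ P.hits B Q j := by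
  simp [frequent]

theorem hits_add_hits_compl (B : Finset P.Node) (Q : Fin P.honest → Fin P.k → P.Node)
    (j : Fin P.honest) : P.hits B Q j + P.hits Bᶜ Q j = P.k := by
  simp only [hits, Finset.mem_compl]
  rw [Finset.card_filter_add_card_filter_not, Finset.card_fin]

theorem card_node : Fintype.card P.Node = P.n := by simp [Params.n]

end Params

instance Sum.discreteMeasurableSpace {α β : Type*} [MeasurableSpace α] [MeasurableSpace β]
    [DiscreteMeasurableSpace α] [DiscreteMeasurableSpace β] : DiscreteMeasurableSpace (α ⊕ β) :=
  ⟨fun _ => measurableSet_sum_iff.2 ⟨.of_discrete, .of_discrete⟩⟩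

theorem uniformLaw_Ioo_le {s r x y : ℝ} (hsr : s < r) (hxy : x ≤ y) :
    (uniformLaw s r).real (Set.Ioo x y) ≤ (y - x) / (r - s) := by
  have h : 0 < r - s := sub_pos.2 hsr
  rw [uniformLaw, map_measureReal_apply (by fun_prop) measurableSet_Ioo]
  have e : (fun t => s + (r - s) * t) ⁻¹' Set.Ioo x y =
      Set.Ioo ((x - s) / (r - s)) ((y - s) / (r - s)) := by
    ext t
    simp only [Set.mem_preimage, Set.mem_Ioo, div_lt_iff₀ h, lt_div_iff₀ h]
    constructor <;> rintro ⟨h1, h2⟩ <;> constructor <;> linarith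
  rw [e]
  calc _ ≤ volume.real (Set.Ioo ((x - s) / (r - s)) ((y - s) / (r - s))) :=
        ENNReal.toReal_mono (by simp) (Measure.restrict_apply_le _ _)
    _ = (y - x) / (r - s) := by
        rw [Real.volume_real_Ioo_of_le (by gcongr)]
        ring

theorem ae_uniformLaw {s r : ℝ} (hsr : s ≤ r) : ∀ᵐ x ∂uniformLaw s r, x ∈ Set.Icc s r := by
  rw [uniformLaw]
  refine (ae_map_iff (by fun_prop) measurableSet_Icc).2 ?_
  filter_upwards [ae_restrict_mem measurableSet_Icc] with t ht
  constructor <;> nlinarith [ht.1, ht.2]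

namespace Execution

variable {P : Params} {Ω : Type*} [mΩ : MeasurableSpace Ω] {μ : Measure Ω}

theorem monotone_info (E : Execution P μ) : Monotone E.info :=
  monotone_nat_of_le_succ fun m => (E.info_le_during m).trans (E.during_le_info m)

theorem measurable_query_apply (E : Execution P μ) (m : ℕ) (j : Fin P.honest) (i : Fin P.k) :
    Measurable fun ω => E.query (m + 1) ω j i := by
  have h : Measurable (E.query (m + 1)) :=
    (E.measurable_query m).mono ((E.during_le_info m).trans (E.info_le _)) le_rfl
  fun_prop

theorem measurable_threshold' (E : Execution P μ) (m : ℕ) : Measurable (E.threshold (m + 1)) :=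
  (E.measurable_threshold m).mono (E.info_le _) le_rfl

theorem ae_threshold_mem (E : Execution P μ) (hβ : P.β < 1 / 2) :
    ∀ᵐ ω ∂μ, ∀ m, 1 ≤ m → E.threshold (m + 1) ω ∈ Set.Icc P.β (1 - P.β) := by
  refine ae_all_iff.2 fun m => ?_
  by_cases hm : 1 ≤ m
  · have h := ae_uniformLaw (s := P.lower (m + 1)) (r := P.upper (m + 1))
      (by simp [Params.lower, Params.upper, show m ≠ 0 by omega]; linarith)
    rw [← E.law_threshold] at h
    have h' := (ae_map_iff (E.measurable_threshold' m).aemeasurable measurableSet_Icc).1 h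
    filter_upwards [h'] with ω hω _
    simpa [Params.lower, Params.upper, show m ≠ 0 by omega] using hω
  · exact ae_of_all _ fun _ h => absurd h hm

variable [IsProbabilityMeasure μ] (E : Execution P μ)

theorem measureReal_query_mem (m : ℕ) (j : Fin P.honest) (i : Fin P.k) (B : Finset P.Node) :
    μ.real {ω | E.query (m + 1) ω j i ∈ B} = B.card / P.n := by
  have e : {ω | E.query (m + 1) ω j i ∈ B} = ⋃ v ∈ B, {ω | E.query (m + 1) ω j i = v} := by
    ext ω; simp
  rw [e, measureReal_biUnion_finset]
  · simp [E.uniform_query, div_eq_mul_inv]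
  · exact fun v _ w _ hvw => Set.disjoint_left.2 fun ω h1 h2 => hvw (h1.symm.trans h2)
  · exact fun v _ => E.measurable_query_apply m j i (.of_discrete (s := {v}))

theorem measureReal_frequent_le (m : ℕ) (B : Finset P.Node) {θ δ : ℝ} (hδ : 0 ≤ δ)
    (hθ : B.card / P.n + δ ≤ θ) (j : Fin P.honest) :
    μ.real {ω | j ∈ P.frequent B θ (E.query (m + 1) ω)} ≤ Real.exp (-2 * P.k * δ ^ 2) := by
  have hi : iIndepFun (fun (i : Fin P.k) ω => E.query (m + 1) ω j i) μ :=
    (E.indep_queries m).precomp (g := fun i => (j, i)) fun a b hab => (Prod.ext_iff.1 hab).2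
  have := measureReal_card_ge_le (E.measurable_query_apply m j) hi
    (B := (B : Set P.Node)) .of_discrete (p := B.card / P.n) hδ
    fun i => (E.measureReal_query_mem m j i B).le
  simp only [Fintype.card_fin, Finset.mem_coe] at this
  refine (measureReal_mono fun ω hω => ?_).trans this
  exact (mul_le_mul_of_nonneg_left hθ (Nat.cast_nonneg _)).trans (P.mem_frequent.1 hω)

/-- Hoeffding's inequality twice: a node sends a proportion `θ` of its queries to `B` with
probability at most `p`, and the proportion of such nodes exceeds `p` by `η` with small
probability. -/
theorem measureReal_card_frequent_ge_le (m : ℕ) (B : Finset P.Node) {θ δ p η : ℝ} (hδ : 0 ≤ δ)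
    (hθ : B.card / P.n + δ ≤ θ) (hp : Real.exp (-2 * P.k * δ ^ 2) ≤ p) (hη : 0 ≤ η) :
    μ.real {ω | P.honest * (p + η) ≤ (P.frequent B θ (E.query (m + 1) ω)).card} ≤
      Real.exp (-2 * P.honest * η ^ 2) := by
  classical
  have hi := iIndepFun_curry (E.measurable_query_apply m) (E.indep_queries m)
  have := measureReal_card_ge_le (μ := μ)
    (X := fun (j : Fin P.honest) ω => (fun i => E.query (m + 1) ω j i))
    (fun j => measurable_pi_lambda _ fun i => E.measurable_query_apply m j i) hi
    (B := {f | P.k * θ ≤ (Finset.univ.filter fun i => f i ∈ B).card}) .of_discrete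
    (p := p) hη fun j => ?_
  · rw [Fintype.card_fin] at this
    exact this
  · refine (measureReal_mono fun ω hω => ?_).trans
      ((E.measureReal_frequent_le m B hδ hθ j).trans hp)
    exact P.mem_frequent.2 hω

/-- Conditionally on the past, an event that depends on the queries of the next round can be
estimated with the past frozen. -/
theorem condProbLE_query {m : ℕ} {κ : Type*} [Finite κ] {Z : Ω → κ}
    (hZ : ∀ z, MeasurableSet[E.info m] {ω | Z ω = z})
    (R : κ → (Fin P.honest → Fin P.k → P.Node) → Prop) {c : ℝ}
    (hc : ∀ z, μ.real {ω | R z (E.query (m + 1) ω)} ≤ c) :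
    CondProbLE μ (E.info m) {ω | R (Z ω) (E.query (m + 1) ω)} c :=
  CondProbLE.of_freeze (R := fun z => {ω | R z (E.query (m + 1) ω)}) (E.info_le m)
    (E.query_indep_info m) hZ (fun z => ⟨{Q | R z Q}, .of_discrete, rfl⟩) hc

theorem condProbLE_threshold {m : ℕ} {κ : Type*} [Finite κ] {Z : Ω → κ}
    (hZ : ∀ z, MeasurableSet[E.info m] {ω | Z ω = z}) {w : ℝ} (hw : 0 ≤ w) (f : κ → ℝ)
    (h : P.lower (m + 1) < P.upper (m + 1)) :
    CondProbLE μ (E.info m) {ω | E.threshold (m + 1) ω ∈ Set.Ioo (f (Z ω)) (f (Z ω) + w)}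
      (w / (P.upper (m + 1) - P.lower (m + 1))) := by
  refine CondProbLE.of_freeze
    (R := fun z => {ω | E.threshold (m + 1) ω ∈ Set.Ioo (f z) (f z + w)}) (E.info_le m)
    (indep_of_indep_of_le_right (E.threshold_indep_during m) (E.info_le_during m)) hZ
    (fun z => ⟨Set.Ioo (f z) (f z + w), measurableSet_Ioo, rfl⟩) fun z => ?_
  have h1 := uniformLaw_Ioo_le h (show f z ≤ f z + w by linarith)
  rw [← E.law_threshold, map_measureReal_apply (E.measurable_threshold' m) measurableSet_Ioo,
    add_sub_cancel_left] at h1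
  exact h1

end Execution

/-! ### Final opinions and measurability -/

namespace FinalBy

variable {m₀ ℓ m m' : ℕ} {x : ℕ → Bool} {v : Bool}

theorem mono (h : FinalBy m₀ ℓ x m v) (hm : m ≤ m') : FinalBy m₀ ℓ x m' v := by
  obtain ⟨s, h1, h2, h3⟩ := h
  exact ⟨s, h1, h2.trans hm, h3⟩

theorem lt (h : FinalBy m₀ ℓ x m v) (hℓ : 1 ≤ ℓ) : m₀ < m := by
  obtain ⟨s, h1, h2, -⟩ := h
  omega

end FinalBy

namespace Execution

variable {P : Params} {Ω : Type*} [mΩ : MeasurableSpace Ω] {μ : Measure Ω} (E : Execution P μ)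

/-- The honest node `j` has a final opinion at the end of round `m`. -/
def IsFinal (m : ℕ) (ω : Ω) (j : Fin P.honest) : Prop :=
  ∃ v, FinalBy P.m₀ P.ℓ (fun t => E.opinion t ω j) m v

/-- The number of `1`-responses that the honest node `j` receives in round `m + 1`. -/
def ones (m : ℕ) (ω : Ω) (j : Fin P.honest) : ℕ :=
  (Finset.univ.filter (fun i : Fin P.k =>
    Sum.elim (fun j' => E.opinion m ω j') (fun e => E.reply (m + 1) ω e j i)
      (E.query (m + 1) ω j i) = true)).card

theorem opinion_succ_eq_true_iff {m : ℕ} {ω : Ω} {j : Fin P.honest} (h : ¬ E.IsFinal m ω j) :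
    E.opinion (m + 1) ω j = true ↔
      E.threshold (m + 1) ω ≤ (P.k : ℝ)⁻¹ * E.ones m ω j :=
  E.opinion_step m ω j h

theorem not_isFinal {m : ℕ} (hm : m ≤ P.m₀) (hℓ : 1 ≤ P.ℓ) (ω : Ω) (j : Fin P.honest) :
    ¬ E.IsFinal m ω j := fun ⟨_, h⟩ => by
  have := h.lt hℓ
  omega

theorem opinion_eq_of_finalBy (hℓ : 1 ≤ P.ℓ) {m : ℕ} {ω : Ω} {j : Fin P.honest} {v : Bool}
    (h : FinalBy P.m₀ P.ℓ (fun t => E.opinion t ω j) m v) : E.opinion m ω j = v := by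
  induction m with
  | zero => exact absurd (h.lt hℓ) (by omega)
  | succ m ih =>
    obtain ⟨s, h1, h2, h3⟩ := h
    rcases Nat.lt_or_ge m (s + P.ℓ) with hs | hs
    · exact h3 (m + 1) (by omega) (by omega)
    · have hm : FinalBy P.m₀ P.ℓ (fun t => E.opinion t ω j) m v := ⟨s, h1, hs, h3⟩
      rw [E.opinion_final m ω j ⟨v, hm⟩, ih hm]

theorem measurable_opinion (m : ℕ) : Measurable[E.info m] (E.opinion m) := by
  induction m using Nat.strong_induction_on with
  | _ m ih =>
  rcases m with _ | m
  · exact E.measurable_initial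
  refine @measurable_pi_lambda _ _ _ (E.info (m + 1)) _ _ fun j =>
    @measurable_to_bool _ (E.info (m + 1)) _ ?_
  have hop : ∀ t ≤ m, ∀ v, MeasurableSet[E.info (m + 1)] {ω | E.opinion t ω j = v} :=
    fun t ht v => E.monotone_info (by omega : t ≤ m + 1) _
      (ih t (by omega) (show MeasurableSet {x : Fin P.honest → Bool | x j = v} from .of_discrete))
  have hF : MeasurableSet[E.info (m + 1)] {ω | E.IsFinal m ω j} := by
    have e : {ω | E.IsFinal m ω j} = ⋃ v : Bool, ⋃ s : ℕ, ⋃ _ : P.m₀ ≤ s ∧ s + P.ℓ ≤ m,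
        ⋂ t : ℕ, ⋂ _ : s < t ∧ t ≤ s + P.ℓ, {ω | E.opinion t ω j = v} := by
      ext ω
      simp only [IsFinal, FinalBy, Set.mem_iUnion, Set.mem_iInter, Set.mem_ofPred_eq]
      exact exists_congr fun v => exists_congr fun s =>
        ⟨fun h => ⟨⟨h.1, h.2.1⟩, fun t ht => h.2.2 t ht.1 ht.2⟩,
          fun ⟨h, h'⟩ => ⟨h.1, h.2, fun t h1 h2 => h' t ⟨h1, h2⟩⟩⟩
    rw [e]
    exact MeasurableSet.iUnion fun v => MeasurableSet.iUnion fun s => MeasurableSet.iUnion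
      fun hs => MeasurableSet.iInter fun t => MeasurableSet.iInter fun ht =>
        hop t (by omega) v
  have hcount : Measurable[E.info (m + 1)] fun ω => E.ones m ω j := by
    let c : (Fin P.honest → Bool) × (Fin P.adv → Fin P.honest → Fin P.k → Bool) ×
        (Fin P.honest → Fin P.k → P.Node) → ℕ := fun z =>
      (Finset.univ.filter (fun i : Fin P.k => Sum.elim (fun j' => z.1 j')
        (fun e => z.2.1 e j i) (z.2.2 j i) = true)).card
    have hc : Measurable c := .of_discrete
    have h1 : Measurable[E.info (m + 1)] (E.opinion m) :=
      (ih m (by omega)).mono (E.monotone_info (Nat.le_succ m)) le_rfl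
    have h2 : Measurable[E.info (m + 1)] (E.reply (m + 1)) :=
      (E.measurable_reply m).mono (E.during_le_info m) le_rfl
    have h3 : Measurable[E.info (m + 1)] (E.query (m + 1)) :=
      (E.measurable_query m).mono (E.during_le_info m) le_rfl
    have h4 : Measurable[E.info (m + 1)] fun ω => (E.reply (m + 1) ω, E.query (m + 1) ω) :=
      h2.prodMk h3
    have h5 : Measurable[E.info (m + 1)] fun ω =>
      (E.opinion m ω, E.reply (m + 1) ω, E.query (m + 1) ω) := h1.prodMk h4
    have h6 := Measurable.comp (g := c) hc h5
    exact h6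
  have hprop : Measurable[E.info (m + 1)] fun ω => (P.k : ℝ)⁻¹ * E.ones m ω j :=
    Measurable.comp (g := fun i : ℕ => (P.k : ℝ)⁻¹ * i) .of_discrete hcount
  have e : (fun ω => E.opinion (m + 1) ω j) ⁻¹' {true} =
      {ω | E.IsFinal m ω j} ∩ {ω | E.opinion m ω j = true} ∪
        {ω | E.IsFinal m ω j}ᶜ ∩
          {ω | E.threshold (m + 1) ω ≤ (P.k : ℝ)⁻¹ * E.ones m ω j} := by
    ext ω
    by_cases h : E.IsFinal m ω j
    · simp [h, E.opinion_final m ω j h]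
    · simp [h, E.opinion_succ_eq_true_iff h]
  rw [e]
  exact (hF.inter (hop m le_rfl true)).union (hF.compl.inter
    (@measurableSet_le _ _ _ _ _ (E.info (m + 1)) _ _ _ _ _ (E.measurable_threshold m) hprop))

end Execution

/-! ### Leaning configurations and their persistence -/

namespace Params

variable (P : Params)

/-- The honest nodes whose opinion in the configuration `x` differs from `v`. -/
def dissenters (v : Bool) (x : Fin P.honest → Bool) : Finset (Fin P.honest) :=
  Finset.univ.filter fun j => x j ≠ v

/-- The nodes that can answer a query by the opposite of `v`: the dissenters and the adversarial
nodes. -/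
def contrary (v : Bool) (x : Fin P.honest → Bool) : Finset P.Node :=
  (P.dissenters v x).disjSum Finset.univ

/-- The configuration `x` leans towards `v`: the proportion of dissenters is within the
tolerance. -/
def Leans (v : Bool) (x : Fin P.honest → Bool) : Prop :=
  ((P.dissenters v x).card : ℝ) ≤ P.tolerance * P.honest

open Classical in
/-- The opinion towards which `x` leans (`false` if there is none). -/
def direction (x : Fin P.honest → Bool) : Bool := decide (P.Leans true x)

variable {P}

theorem mem_dissenters {v : Bool} {x : Fin P.honest → Bool} {j : Fin P.honest} :
    j ∈ P.dissenters v x ↔ x j ≠ v := by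
  simp [dissenters]

theorem Leans.direction_eq (h : P.Admissible) {v : Bool} {x : Fin P.honest → Bool}
    (hv : P.Leans v x) : P.direction x = v := by
  cases v with
  | true => simp [direction, hv]
  | false =>
    simp only [direction, decide_eq_false_iff_not]
    intro ht
    have hcard : (P.dissenters false x).card + (P.dissenters true x).card = P.honest := by
      have e : P.dissenters true x = Finset.univ.filter fun j => ¬ x j ≠ false := by
        ext j; simp [dissenters]
      rw [e, dissenters, Finset.card_filter_add_card_filter_not, Finset.card_fin]
    have h1 : ((P.dissenters false x).card : ℝ) + (P.dissenters true x).card = P.honest := by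
      exact_mod_cast hcard
    have h2 : (0 : ℝ) < P.honest := Nat.cast_pos.2 h.honest_pos
    unfold Leans at hv ht
    nlinarith [h.tolerance_lt]

theorem Leans.card_contrary_div_le (h : P.Admissible) {v : Bool} {x : Fin P.honest → Bool}
    (hv : P.Leans v x) :
    ((P.contrary v x).card : ℝ) / P.n + (P.β - P.q) / 2 ≤ P.β := by
  have hn := h.n_pos
  have h1 : ((P.contrary v x).card : ℝ) ≤ (P.tolerance * (1 - P.q) + P.q) * P.n := by
    rw [contrary, Finset.card_disjSum, Finset.card_fin, Nat.cast_add, add_mul, h.q_mul_n, mul_assoc,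
      ← h.honest_eq]
    gcongr
    exact hv
  rw [h.tolerance_mul] at h1
  have := (div_le_iff₀ hn).2 h1
  linarith

end Params

open Params

namespace Execution

variable {P : Params} {Ω : Type*} [mΩ : MeasurableSpace Ω] {μ : Measure Ω} (E : Execution P μ)

/-- In round `m + 1` the honest node `j` sends at least a proportion `β` of its queries to nodes
that can answer by the opposite of `v`. -/
def Misled (m : ℕ) (v : Bool) (ω : Ω) (j : Fin P.honest) : Prop :=
  j ∈ P.frequent (P.contrary v (E.opinion m ω)) P.β (E.query (m + 1) ω)

/-- The `1`-responses can only come from nodes contrary to `0`, whatever the adversary does. -/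
theorem ones_le_hits_contrary (m : ℕ) (ω : Ω) (j : Fin P.honest) :
    E.ones m ω j ≤ P.hits (P.contrary false (E.opinion m ω)) (E.query (m + 1) ω) j := by
  refine Finset.card_le_card fun i hi => Finset.mem_filter.2 ⟨Finset.mem_univ _, ?_⟩
  have h := (Finset.mem_filter.1 hi).2
  unfold contrary
  rcases hq : E.query (m + 1) ω j i with j' | e <;> simp_all [mem_dissenters]

theorem hits_compl_contrary_le_ones (m : ℕ) (ω : Ω) (j : Fin P.honest) :
    P.hits (P.contrary true (E.opinion m ω))ᶜ (E.query (m + 1) ω) j ≤ E.ones m ω j := by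
  refine Finset.card_le_card fun i hi => Finset.mem_filter.2 ⟨Finset.mem_univ _, ?_⟩
  have h := Finset.mem_compl.1 (Finset.mem_filter.1 hi).2
  unfold contrary at h
  rcases hq : E.query (m + 1) ω j i with j' | e <;> simp_all [mem_dissenters]

/-- A node adopts an opinion other than `v` only if it is misled, once the threshold is in
`[β, 1 - β]`. -/
theorem misled_of_opinion_ne (hk : 0 < P.k) {m : ℕ} {ω : Ω}
    (hX : E.threshold (m + 1) ω ∈ Set.Icc P.β (1 - P.β)) {j : Fin P.honest}
    (hj : ¬ E.IsFinal m ω j) {v : Bool} (hv : E.opinion (m + 1) ω j ≠ v) : E.Misled m v ω j := by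
  have hk' : (0 : ℝ) < P.k := Nat.cast_pos.2 hk
  have hiff := E.opinion_succ_eq_true_iff hj
  rw [inv_mul_eq_div, le_div_iff₀ hk'] at hiff
  refine P.mem_frequent.2 ?_
  cases v with
  | false =>
    have h1 := hiff.1 (by simpa using hv)
    have h2 : (E.ones m ω j : ℝ) ≤ P.hits (P.contrary false (E.opinion m ω))
      (E.query (m + 1) ω) j := Nat.cast_le.2 (E.ones_le_hits_contrary m ω j)
    nlinarith [hX.1]
  | true =>
    have h1 := not_le.1 fun h => hv (hiff.2 h)
    have h2 : (P.hits (P.contrary true (E.opinion m ω))ᶜ (E.query (m + 1) ω) j : ℝ) ≤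
      E.ones m ω j := Nat.cast_le.2 (E.hits_compl_contrary_le_ones m ω j)
    have h3 : (P.hits (P.contrary true (E.opinion m ω)) (E.query (m + 1) ω) j : ℝ) +
        P.hits (P.contrary true (E.opinion m ω))ᶜ (E.query (m + 1) ω) j = P.k := by
      exact_mod_cast P.hits_add_hits_compl _ _ _
    nlinarith [hX.2]

/-- In round `m + 1` the proportion of misled nodes exceeds the tolerance, although the system leant
towards an opinion. -/
def manyMisled (m : ℕ) : Set Ω :=
  {ω | P.Leans (P.direction (E.opinion m ω)) (E.opinion m ω) ∧ P.tolerance * P.honest ≤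
    (P.frequent (P.contrary (P.direction (E.opinion m ω)) (E.opinion m ω)) P.β
      (E.query (m + 1) ω)).card}

/-- Conditions on the trajectory `ω` under which the lean towards an opinion persists from round
`1` to round `M`: the later thresholds are in `[β, 1 - β]`, and in no round too many nodes are
misled. -/
structure Steady (M : ℕ) (ω : Ω) : Prop where
  threshold_mem : ∀ m, 1 ≤ m → E.threshold (m + 1) ω ∈ Set.Icc P.β (1 - P.β)
  notMem_manyMisled : ∀ m, 1 ≤ m → m < M → ω ∉ E.manyMisled m

variable {E}

theorem Steady.leans_succ {M : ℕ} {ω : Ω} (hS : E.Steady M ω) (hP : P.Admissible) {m : ℕ}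
    (hm : 1 ≤ m) (hmM : m < M) {v : Bool} (hv : P.Leans v (E.opinion m ω))
    (hfin : ∀ j, E.IsFinal m ω j → E.opinion m ω j = v) : P.Leans v (E.opinion (m + 1) ω) := by
  have h := hS.notMem_manyMisled m hm hmM
  simp only [manyMisled, Set.mem_ofPred_eq, hv.direction_eq hP, hv, true_and, not_le] at h
  refine le_trans (Nat.cast_le.2 (Finset.card_le_card fun j hj => ?_)) h.le
  rw [mem_dissenters] at hj
  refine E.misled_of_opinion_ne hP.k_pos (hS.threshold_mem m hm) (fun hf => hj ?_) hj
  rw [E.opinion_final m ω j hf, hfin j hf]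

theorem Steady.exists_leans {M : ℕ} {ω : Ω} (hS : E.Steady M ω) (hP : P.Admissible)
    (hM : P.m₀ ≤ M) {m : ℕ} (hm : 1 ≤ m) (hm₀ : m ≤ P.m₀)
    (h : ∃ v, P.Leans v (E.opinion m ω)) : ∃ v, P.Leans v (E.opinion P.m₀ ω) := by
  obtain ⟨v, hv⟩ := h
  refine ⟨v, Nat.le_induction (P := fun t _ => t ≤ P.m₀ → P.Leans v (E.opinion t ω))
    (fun _ => hv) (fun t ht ih hle => ?_) P.m₀ hm₀ le_rfl⟩
  exact hS.leans_succ hP (hm.trans ht) (by omega) (ih (by omega)) fun j hj =>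
    absurd hj (E.not_isFinal (by omega) hP.ℓ_pos ω j)

variable (E)

/-- Trial `t` after the cooling-off period is a failure for the node `j`: the system still leans
towards the opinion `v` it had leant to at the end of that period, and `j` is misled. -/
def failure (j : Fin P.honest) (t : ℕ) : Set Ω :=
  {ω | P.Leans (P.direction (E.opinion P.m₀ ω)) (E.opinion (P.m₀ + t) ω) ∧
    E.Misled (P.m₀ + t) (P.direction (E.opinion P.m₀ ω)) ω j}

variable {E}

theorem opinion_eq_of_not_mem_failure {ω : Ω} (hP : P.Admissible) (hm₀ : 1 ≤ P.m₀)
    (hX : ∀ m, 1 ≤ m → E.threshold (m + 1) ω ∈ Set.Icc P.β (1 - P.β)) {v : Bool}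
    (hv : P.Leans v (E.opinion P.m₀ ω)) {t : ℕ} {j : Fin P.honest}
    (hvt : P.Leans v (E.opinion (P.m₀ + t) ω)) (hj : ¬ E.IsFinal (P.m₀ + t) ω j)
    (hf : ω ∉ E.failure j t) : E.opinion (P.m₀ + t + 1) ω j = v := by
  by_contra hne
  refine hf ?_
  simp only [failure, Set.mem_ofPred_eq, hv.direction_eq hP]
  exact ⟨hvt, E.misled_of_opinion_ne hP.k_pos (hX _ (by omega)) hj hne⟩

/-- A run of `ℓ` successes makes `v` final, as long as the opposite opinion is not final. -/
theorem finalBy_of_not_mem_failure {ω : Ω} (hP : P.Admissible) (hm₀ : 1 ≤ P.m₀)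
    (hX : ∀ m, 1 ≤ m → E.threshold (m + 1) ω ∈ Set.Icc P.β (1 - P.β)) {v : Bool}
    (hv : P.Leans v (E.opinion P.m₀ ω)) {s : ℕ} {j : Fin P.honest}
    (hvs : ∀ t, t < s + P.ℓ → P.Leans v (E.opinion (P.m₀ + t) ω))
    (hno : ∀ t, t < s + P.ℓ → ¬ FinalBy P.m₀ P.ℓ (fun t => E.opinion t ω j) (P.m₀ + t) (!v))
    (hrun : ∀ t, s ≤ t → t < s + P.ℓ → ω ∉ E.failure j t) :
    FinalBy P.m₀ P.ℓ (fun t => E.opinion t ω j) (P.m₀ + (s + P.ℓ)) v := by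
  by_cases hfin : ∃ t, t < s + P.ℓ ∧ E.IsFinal (P.m₀ + t) ω j
  · obtain ⟨t, ht, w, hw⟩ := hfin
    by_cases hwv : w = v
    · exact hwv ▸ hw.mono (by omega)
    · rw [show w = !v by cases w <;> cases v <;> simp_all] at hw
      exact absurd hw (hno t ht)
  · push Not at hfin
    refine ⟨P.m₀ + s, by omega, by omega, fun t h1 h2 => ?_⟩
    obtain ⟨i, rfl⟩ : ∃ i, t = P.m₀ + i + 1 := ⟨t - P.m₀ - 1, by omega⟩
    exact opinion_eq_of_not_mem_failure hP hm₀ hX hv (hvs i (by omega)) (hfin i (by omega))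
      (hrun i (by omega) (by omega))

/-- If no node loses the race between runs of failures and successes, then the system keeps leaning
towards `v`, and the opposite opinion becomes final for no node. -/
theorem Steady.leans_and_not_finalBy {T : ℕ} {ω : Ω} (hS : E.Steady (P.m₀ + T) ω)
    (hP : P.Admissible) (hm₀ : 1 ≤ P.m₀) {v : Bool} (hv : P.Leans v (E.opinion P.m₀ ω))
    (hrace : ∀ j, ¬ RaceLost P.ℓ (fun t => ω ∈ E.failure j t) T 0 0 0) (t : ℕ) (ht : t ≤ T) :
    P.Leans v (E.opinion (P.m₀ + t) ω) ∧
      ∀ j, ¬ FinalBy P.m₀ P.ℓ (fun t => E.opinion t ω j) (P.m₀ + t) (!v) := by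
  have hℓ := hP.ℓ_pos
  induction t using Nat.strong_induction_on with
  | _ t ih =>
  rcases t with _ | t
  · exact ⟨hv, fun j h => absurd (h.lt hℓ) (by omega)⟩
  have hfin : ∀ s ≤ t, ∀ j, E.IsFinal (P.m₀ + s) ω j →
      FinalBy P.m₀ P.ℓ (fun t => E.opinion t ω j) (P.m₀ + s) v := by
    rintro s hs j ⟨w, hw⟩
    by_cases hwv : w = v
    · exact hwv ▸ hw
    · rw [show w = !v by cases w <;> cases v <;> simp_all] at hw
      exact absurd hw ((ih s (by omega) (by omega)).2 j)
  refine ⟨hS.leans_succ (m := P.m₀ + t) hP (by omega) (by omega) (ih t (by omega) (by omega)).1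
    fun j hj => E.opinion_eq_of_finalBy hℓ (hfin t le_rfl j hj), fun j hj => hrace j ?_⟩
  obtain ⟨s, h1, h2, h3⟩ := hj
  change ∀ t, s < t → t ≤ s + P.ℓ → E.opinion t ω j = !v at h3
  have hs : s + P.ℓ = P.m₀ + (t + 1) := by
    by_contra hne
    exact (ih t (by omega) (by omega)).2 j ⟨s, h1, by omega, h3⟩
  -- the run of dissent that would make `!v` final consists of failures
  have hnf : ∀ i, t + 1 ≤ i + P.ℓ → i < t + 1 → ¬ E.IsFinal (P.m₀ + i) ω j := by
    intro i hi1 hi2 hf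
    have h4 := E.opinion_eq_of_finalBy hℓ ((hfin i (by omega) j hf))
    have h5 := E.opinion_final (P.m₀ + i) ω j hf
    rw [h4, h3 (P.m₀ + i + 1) (by omega) (by omega)] at h5
    cases v <;> simp at h5
  refine raceLost_of_run (e := t + 1) hℓ (by omega) (fun i hi1 hi2 => ?_) (fun r hr => ?_) T 0 0 0
    (by omega) (by omega) (fun r hr _ => by omega) ⟨le_rfl, fun i hi => absurd hi (by omega)⟩
  · by_contra hf
    have h4 := opinion_eq_of_not_mem_failure hP hm₀ hS.threshold_mem hv
      (ih i (by omega) (by omega)).1 (hnf i hi1 hi2) hf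
    rw [h3 (P.m₀ + i + 1) (by omega) (by omega)] at h4
    cases v <;> simp at h4
  · by_contra hcon
    push Not at hcon
    have h4 := finalBy_of_not_mem_failure (s := r) hP hm₀ hS.threshold_mem hv
      (fun i hi => (ih i (by omega) (by omega)).1)
      (fun i hi => (ih i (by omega) (by omega)).2 j) hcon
    exact hnf (t + 1 - P.ℓ) (by omega) (by omega) ⟨v, h4.mono (by omega)⟩

theorem mem_consensusBy {u : ℕ} {ω : Ω} {v : Bool}
    (h : ∀ j, FinalBy P.m₀ P.ℓ (fun t => E.opinion t ω j) (P.m₀ + P.ℓ * u) v) :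
    ω ∈ E.consensusBy u := by
  have hH : ω ∈ E.H v := fun j => ⟨_, h j⟩
  refine ⟨?_, show E.rounds ω ≤ _ from
    biInf_le (fun m : ℕ => (m : ℕ∞)) (show _ ∈ {m : ℕ | _} from fun j => ⟨v, h j⟩)⟩
  cases v
  · exact Or.inl hH
  · exact Or.inr hH

theorem Steady.mem_consensusBy {u : ℕ} {ω : Ω} (hS : E.Steady (P.m₀ + P.ℓ * u) ω)
    (hP : P.Admissible) (hlean : ∃ m, 1 ≤ m ∧ m ≤ P.m₀ ∧ ∃ v, P.Leans v (E.opinion m ω))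
    (hrace : ∀ j, ¬ RaceLost P.ℓ (fun t => ω ∈ E.failure j t) (P.ℓ * u) 0 0 0)
    (hblock : ∀ j, ∃ b < u, ∀ i < P.ℓ, ω ∉ E.failure j (P.ℓ * b + i)) :
    ω ∈ E.consensusBy u := by
  obtain ⟨m, hm, hmm, hl⟩ := hlean
  obtain ⟨v, hv⟩ := hS.exists_leans hP (by omega) hm hmm hl
  have key := hS.leans_and_not_finalBy hP (by omega) hv hrace
  refine Execution.mem_consensusBy (v := v) fun j => ?_
  obtain ⟨b, hb, hrun⟩ := hblock j
  have hbu : P.ℓ * b + P.ℓ ≤ P.ℓ * u := by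
    rw [← Nat.mul_succ]; exact Nat.mul_le_mul_left _ hb
  refine (finalBy_of_not_mem_failure (s := P.ℓ * b) hP (by omega) hS.threshold_mem hv
    (fun t ht => (key t (by omega)).1) (fun t ht => (key t (by omega)).2 j)
    fun t h1 h2 => ?_).mono (by omega)
  obtain ⟨i, rfl⟩ := Nat.exists_eq_add_of_le h1
  exact hrun i (by omega)

end Execution

/-! ### Probability estimates -/

namespace Execution

variable {P : Params} {Ω : Type*} [mΩ : MeasurableSpace Ω] {μ : Measure Ω} (E : Execution P μ)

theorem measurableSet_opinion_and_opinion_and_query {m m' : ℕ} (h : m ≤ m')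
    (R : (Fin P.honest → Bool) → (Fin P.honest → Bool) →
      (Fin P.honest → Fin P.k → P.Node) → Prop) :
    MeasurableSet[E.info (m' + 1)]
      {ω | R (E.opinion m ω) (E.opinion m' ω) (E.query (m' + 1) ω)} := by
  have h1 : Measurable[E.info (m' + 1)] (E.opinion m) :=
    (E.measurable_opinion m).mono (E.monotone_info (by omega)) le_rfl
  have h2 : Measurable[E.info (m' + 1)] (E.opinion m') :=
    (E.measurable_opinion m').mono (E.monotone_info (by omega)) le_rfl
  have h3 : Measurable[E.info (m' + 1)] (E.query (m' + 1)) :=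
    (E.measurable_query m').mono (E.during_le_info m') le_rfl
  have h4 : MeasurableSet {z : (Fin P.honest → Bool) × (Fin P.honest → Bool) ×
      (Fin P.honest → Fin P.k → P.Node) | R z.1 z.2.1 z.2.2} := .of_discrete
  exact (h1.prodMk (h2.prodMk h3)) h4

theorem measurableSet_opinion (m : ℕ) (R : (Fin P.honest → Bool) → Prop) :
    MeasurableSet[E.info m] {ω | R (E.opinion m ω)} :=
  E.measurable_opinion m (show MeasurableSet {x | R x} from .of_discrete)

theorem measurableSet_failure (j : Fin P.honest) (t : ℕ) :
    MeasurableSet[E.info (P.m₀ + (t + 1))] (E.failure j t) :=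
  E.measurableSet_opinion_and_opinion_and_query (Nat.le_add_right P.m₀ t) fun x y Q =>
    P.Leans (P.direction x) y ∧ j ∈ P.frequent (P.contrary (P.direction x) y) P.β Q

variable [IsProbabilityMeasure μ]

theorem exp_half_eq_err (P : Params) :
    Real.exp (-2 * P.k * ((P.β - P.q) / 2) ^ 2) = P.err := by
  rw [err]; congr 1; ring

theorem condProbLE_failure (hP : P.Admissible) (j : Fin P.honest) (t : ℕ) :
    CondProbLE μ (E.info (P.m₀ + t)) (E.failure j t) P.err := by
  refine E.condProbLE_query (m := P.m₀ + t)
    (Z := fun ω => (E.opinion P.m₀ ω, E.opinion (P.m₀ + t) ω)) (fun z => ?_)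
    (fun z Q => P.Leans (P.direction z.1) z.2 ∧
      j ∈ P.frequent (P.contrary (P.direction z.1) z.2) P.β Q) fun z => ?_
  · simp only [Prod.ext_iff, Set.ofPred_and]
    exact (E.monotone_info (Nat.le_add_right _ _) _ (E.measurableSet_opinion _ (· = z.1))).inter
      (E.measurableSet_opinion _ (· = z.2))
  · by_cases hz : P.Leans (P.direction z.1) z.2
    · simp only [hz, true_and, ← exp_half_eq_err]
      exact E.measureReal_frequent_le _ _ (by linarith [hP.q_lt])
        (hz.card_contrary_div_le hP) j
    · simpa [hz] using P.err_pos.le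

theorem measureReal_manyMisled_le (hP : P.Admissible) (m : ℕ) :
    μ.real (E.manyMisled m) ≤ Real.exp (-2 * P.honest * P.phi ^ 2) := by
  refine (E.condProbLE_query (m := m) (Z := E.opinion m)
    (fun z => E.measurableSet_opinion m (· = z))
    (fun z Q => P.Leans (P.direction z) z ∧ P.tolerance * P.honest ≤
      (P.frequent (P.contrary (P.direction z) z) P.β Q).card) fun z => ?_).measureReal_le
  by_cases hz : P.Leans (P.direction z) z
  · have h := E.measureReal_card_frequent_ge_le m (P.contrary (P.direction z) z)
      (by linarith [hP.q_lt]) (hz.card_contrary_div_le hP) (exp_half_eq_err P).le hP.phi_pos.le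
    simpa only [hz, true_and, P.phi_eq, add_sub_cancel, mul_comm (P.honest : ℝ) P.tolerance] using h
  · simpa [hz] using (Real.exp_pos _).le

/-- After round `m` the system leans towards neither opinion. -/
def undecided (m : ℕ) : Set Ω := {ω | ¬ ∃ v, P.Leans v (E.opinion m ω)}

/-- If the `1`-responses of each node are at least its queries to `BL` and at most its queries to
`BU`, where `BL` and `BU` are known before the round and differ by a proportion `d` of the nodes,
then the system stays undecided only if the threshold falls into an interval of length `d + width`
or if many nodes see a proportion that deviates by `width / 2` from its mean. -/
theorem condProbLE_undecided (hP : P.Admissible) {m : ℕ} (hm : m < P.m₀)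
    (hspread : 1 - 2 * P.β ≤ P.upper (m + 1) - P.lower (m + 1)) {d : ℝ} (hd : 0 ≤ d)
    {κ : Type*} [Finite κ] {Z : Ω → κ} (hZ : ∀ z, MeasurableSet[E.info m] {ω | Z ω = z})
    (BL BU : κ → Finset P.Node) (hcard : ∀ z, ((BU z).card : ℝ) ≤ (BL z).card + d * P.n)
    (hL : ∀ ω j, P.hits (BL (Z ω)) (E.query (m + 1) ω) j ≤ E.ones m ω j)
    (hU : ∀ ω j, E.ones m ω j ≤ P.hits (BU (Z ω)) (E.query (m + 1) ω) j) :
    CondProbLE μ (E.info m) (E.undecided (m + 1))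
      (2 * Real.exp (-(1 / 8) * P.n * ((P.β - P.q) ^ 2 / (4 * (1 - P.q)))) +
        (d + P.width) / (1 - 2 * P.β)) := by
  have hn := hP.n_pos
  have hw := P.width_nonneg
  have hk : (0 : ℝ) < P.k := Nat.cast_pos.2 hP.k_pos
  have hβ : 0 < 1 - 2 * P.β := by linarith [hP.β_lt]
  have hX := E.condProbLE_threshold hZ (add_nonneg hd hw)
    (fun z => (BL z).card / P.n - P.width / 2) (by linarith)
  have hdev : ∀ B : κ → Finset P.Node, CondProbLE μ (E.info m)
      {ω | P.honest * (P.tolerance / 2 + P.tolerance / 2) ≤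
        ((P.frequent (B (Z ω)) ((B (Z ω)).card / P.n + P.width / 2)
          (E.query (m + 1) ω)).card : ℝ)}
      (Real.exp (-(1 / 8) * P.n * ((P.β - P.q) ^ 2 / (4 * (1 - P.q))))) := fun B =>
    E.condProbLE_query hZ (fun z Q => P.honest * (P.tolerance / 2 + P.tolerance / 2) ≤
        ((P.frequent (B z) ((B z).card / P.n + P.width / 2) Q).card : ℝ)) fun z =>
      (E.measureReal_card_frequent_ge_le m (B z) (by positivity) le_rfl hP.exp_width.le
        (by linarith [hP.tolerance_pos])).trans hP.exp_tolerance_le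
  refine (((hX.union (hdev BU)).union (hdev fun z => (BL z)ᶜ)).mono fun ω hω => ?_).le_const ?_
  · simp only [undecided, Set.mem_ofPred_eq, not_exists, Leans, not_le, mul_comm P.tolerance] at hω
    simp only [Set.mem_union, Set.mem_ofPred_eq, add_halves, Set.mem_Ioo]
    have hop := fun j => E.opinion_succ_eq_true_iff (E.not_isFinal hm.le hP.ℓ_pos ω j)
    simp only [inv_mul_eq_div, le_div_iff₀ hk] at hop
    by_contra! hcon
    obtain ⟨⟨hcon, hBU⟩, hBL⟩ := hcon
    rcases le_or_gt (E.threshold (m + 1) ω) ((BL (Z ω)).card / P.n - P.width / 2) with hlo | hlo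
    · -- low threshold: a node adopts `0` only if it asks the complement of `BL` too often
      refine absurd ((hω true).trans_le (Nat.cast_le.2 (Finset.card_le_card fun j hj => ?_)))
        (not_lt.2 hBL.le)
      rw [mem_dissenters] at hj
      have h1 := not_le.1 fun h => hj ((hop j).2 h)
      have h2 : (P.hits (BL (Z ω)) (E.query (m + 1) ω) j : ℝ) ≤ E.ones m ω j :=
        Nat.cast_le.2 (hL ω j)
      have h3 : (P.hits (BL (Z ω)) (E.query (m + 1) ω) j : ℝ) +
          P.hits (BL (Z ω))ᶜ (E.query (m + 1) ω) j = P.k := by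
        exact_mod_cast P.hits_add_hits_compl _ _ _
      have h4 : (((BL (Z ω))ᶜ.card : ℝ)) / P.n = 1 - (BL (Z ω)).card / P.n := by
        have : ((BL (Z ω)).card : ℝ) + (BL (Z ω))ᶜ.card = P.n := by
          exact_mod_cast (Finset.card_add_card_compl _).trans P.card_node
        rw [eq_sub_iff_add_eq, ← add_div, add_comm, this, div_self hn.ne']
      rw [P.mem_frequent, h4]
      nlinarith
    · have hhi := hcon hlo
      have h4 : ((BU (Z ω)).card : ℝ) / P.n ≤ (BL (Z ω)).card / P.n + d := by
        rw [div_le_iff₀ hn, add_mul, div_mul_cancel₀ _ hn.ne']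
        exact hcard (Z ω)
      -- high threshold: a node adopts `1` only if it asks `BU` too often
      refine absurd ((hω false).trans_le (Nat.cast_le.2 (Finset.card_le_card fun j hj => ?_)))
        (not_lt.2 hBU.le)
      rw [mem_dissenters] at hj
      have h1 := (hop j).1 (by simpa using hj)
      have h2 : (E.ones m ω j : ℝ) ≤ P.hits (BU (Z ω)) (E.query (m + 1) ω) j :=
        Nat.cast_le.2 (hU ω j)
      rw [P.mem_frequent]
      nlinarith
  · have : (d + P.width) / (P.upper (m + 1) - P.lower (m + 1)) ≤
        (d + P.width) / (1 - 2 * P.β) := by gcongr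
    linarith

theorem condProbLE_undecided_berserk (hP : P.Admissible) {m : ℕ} (hm : m < P.m₀)
    (hspread : 1 - 2 * P.β ≤ P.upper (m + 1) - P.lower (m + 1)) :
    CondProbLE μ (E.info m) (E.undecided (m + 1)) P.psiBer := by
  refine E.condProbLE_undecided hP hm hspread P.q_nonneg
    (fun z => E.measurableSet_opinion m (· = z)) (fun x => (P.contrary true x)ᶜ)
    (fun x => P.contrary false x) (fun x => ?_) (E.hits_compl_contrary_le_ones m)
    (E.ones_le_hits_contrary m)
  have h1 : (P.contrary false x).card ≤ (P.contrary true x)ᶜ.card + P.adv := by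
    rw [contrary, Finset.card_disjSum, Finset.card_fin, ← Finset.card_map Function.Embedding.inl]
    refine Nat.add_le_add_right (Finset.card_le_card fun z hz => ?_) _
    obtain ⟨j, hj, rfl⟩ := Finset.mem_map.1 hz
    have := mem_dissenters.1 hj
    simp_all [contrary, mem_dissenters]
  rw [hP.q_mul_n]
  exact_mod_cast h1

theorem condProbLE_undecided_cautious (hP : P.Admissible) (hE : E.IsCautious) {m : ℕ}
    (hm : m < P.m₀) (hspread : 1 - 2 * P.β ≤ P.upper (m + 1) - P.lower (m + 1)) :
    CondProbLE μ (E.info m) (E.undecided (m + 1)) P.psiCau := by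
  let j₀ : Fin P.honest := ⟨0, hP.honest_pos⟩
  let i₀ : Fin P.k := ⟨0, hP.k_pos⟩
  -- the nodes that answer `1` in this round are known before it starts
  let B : (Fin P.honest → Bool) × (Fin P.adv → Fin P.honest → Fin P.k → Bool) → Finset P.Node :=
    fun z => (P.dissenters false z.1).disjSum (Finset.univ.filter fun e => z.2 e j₀ i₀ = true)
  have hB : ∀ ω j, E.ones m ω j =
      P.hits (B (E.opinion m ω, E.reply (m + 1) ω)) (E.query (m + 1) ω) j := fun ω j => by
    refine congrArg Finset.card (Finset.filter_congr fun i _ => ?_)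
    rcases hq : E.query (m + 1) ω j i with j' | e
    · simp [B, mem_dissenters]
    · simp [B, hE.2 m ω e j i j₀ i₀]
  have h := E.condProbLE_undecided hP hm hspread le_rfl
    (Z := fun ω => (E.opinion m ω, E.reply (m + 1) ω)) (fun z => ?_) B B (fun z => by simp)
    (fun ω j => (hB ω j).ge) fun ω j => (hB ω j).le
  · refine h.le_const (le_of_eq ?_)
    rw [psiCau, zero_add, inv_mul_eq_div]
  · simp only [Prod.ext_iff, Set.ofPred_and]
    exact (E.measurableSet_opinion m (· = z.1)).inter
      (hE.1 m (show MeasurableSet {r | r = z.2} from .of_discrete))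

/-- The consensus estimate, from a bound `c` for the conditional probability of being undecided
after each of the rounds `s + 1, …, m₀`. -/
theorem le_measureReal_consensusBy (hP : P.Admissible) (u s : ℕ) {c : ℝ}
    (hc : 0 ≤ c) (hs : ∀ m, s ≤ m → m < P.m₀ →
      CondProbLE μ (E.info m) (E.undecided (m + 1)) c) :
    1 - P.W u - c ^ (P.m₀ - s) ≤ μ.real (E.consensusBy u) := by
  set M := P.m₀ + P.ℓ * u with hM
  set A₀ : Set Ω := {ω | ∀ i < P.m₀ - s, ω ∈ E.undecided (s + i + 1)} with hA₀
  set A₁ : Set Ω := ⋃ m ∈ Finset.Ico 1 M, E.manyMisled m with hA₁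
  set A₂ : Set Ω := ⋃ j, {ω | RaceLost P.ℓ (fun t => ω ∈ E.failure j t) (P.ℓ * u) 0 0 0} with hA₂
  set A₃ : Set Ω := ⋃ j, {ω | ∀ b < u, ∃ i < P.ℓ, ω ∈ E.failure j (P.ℓ * b + i)} with hA₃
  have herr : 0 ≤ P.err := P.err_pos.le
  have hfilt : Monotone fun t => E.info (P.m₀ + t) := fun a b hab =>
    E.monotone_info (Nat.add_le_add_left hab _)
  have h₀ : μ.real A₀ ≤ c ^ (P.m₀ - s) := by
    have h := measureReal_inter_forall_le (μ := μ) (ℱ := fun t => E.info (s + t))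
      (S := fun t => {ω | s + t < P.m₀ ∧ ω ∈ E.undecided (s + t + 1)}) (c := c)
      (fun t => E.measurableSet_opinion (s + t + 1) fun x => s + t < P.m₀ ∧ ¬ ∃ v, P.Leans v x)
      (fun a b hab => E.monotone_info (Nat.add_le_add_left hab _)) hc (fun t => ?_)
      (P.m₀ - s) 0 (A := Set.univ) MeasurableSet.univ
    · rw [Set.univ_inter, probReal_univ, mul_one] at h
      refine (measureReal_mono fun ω hω i hi => ?_).trans h
      rw [Nat.zero_add]
      exact ⟨by omega, hω i hi⟩
    · by_cases ht : s + t < P.m₀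
      · exact (hs (s + t) (by omega) ht).mono fun ω hω => hω.2
      · intro A _
        simpa [ht] using mul_nonneg hc measureReal_nonneg
  have h₁ : μ.real A₁ ≤ (P.m₀ + P.ℓ * u) * Real.exp (-2 * (1 - P.q) * P.n * P.phi ^ 2) := by
    have e : -2 * (1 - P.q) * P.n * P.phi ^ 2 = -2 * P.honest * P.phi ^ 2 := by
      rw [hP.honest_eq]; ring
    rw [e]
    calc μ.real A₁ ≤ ∑ m ∈ Finset.Ico 1 M, μ.real (E.manyMisled m) :=
          measureReal_biUnion_finset_le _ _
      _ ≤ ∑ _m ∈ Finset.Ico 1 M, Real.exp (-2 * P.honest * P.phi ^ 2) :=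
          Finset.sum_le_sum fun m _ => E.measureReal_manyMisled_le hP m
      _ = ((M - 1 : ℕ) : ℝ) * Real.exp (-2 * P.honest * P.phi ^ 2) := by simp
      _ ≤ (M : ℝ) * Real.exp (-2 * P.honest * P.phi ^ 2) := by
          gcongr; exact Nat.sub_le _ _
      _ = _ := by rw [hM]; push_cast; rfl
  have h₂ : μ.real A₂ ≤ P.honest * (P.err / (1 - P.err)) ^ (P.ℓ - 1) := by
    refine (measureReal_iUnion_fintype_le _).trans ((Finset.sum_le_sum fun j _ =>
      measureReal_raceLost_le (E.measurableSet_failure j) hfilt (fun t => E.info_le _) herr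
        hP.err_lt.le (E.condProbLE_failure hP j) hP.ℓ_pos (P.ℓ * u)).trans ?_)
    simp
  have h₃ : μ.real A₃ ≤ P.honest * (1 - (1 - P.err) ^ P.ℓ) ^ u := by
    have h1 : 0 ≤ 1 - (1 - P.err) ^ P.ℓ := sub_nonneg.2
      (pow_le_one₀ (by linarith [hP.err_lt]) (by linarith))
    have hblock : ∀ j, μ.real {ω | ∀ b < u, ∃ i < P.ℓ, ω ∈ E.failure j (P.ℓ * b + i)} ≤
        (1 - (1 - P.err) ^ P.ℓ) ^ u := fun j => by
      have h := measureReal_inter_forall_le (μ := μ) (ℱ := fun b => E.info (P.m₀ + P.ℓ * b))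
        (S := fun b => {ω | ∃ i < P.ℓ, ω ∈ E.failure j (P.ℓ * b + i)}) (fun b => ?_)
        (fun a b hab => hfilt (Nat.mul_le_mul_left _ hab)) h1
        (fun b => condProbLE_exists (ℱ := fun t => E.info (P.m₀ + t)) (E.measurableSet_failure j)
          hfilt (fun t => E.info_le _) (by linarith [hP.err_lt]) (E.condProbLE_failure hP j)
          P.ℓ (P.ℓ * b)) u 0 (A := Set.univ) MeasurableSet.univ
      · simpa using h
      · have e : {ω | ∃ i < P.ℓ, ω ∈ E.failure j (P.ℓ * b + i)} =
            ⋃ i, ⋃ _ : i < P.ℓ, E.failure j (P.ℓ * b + i) := by ext ω; simp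
        rw [e]
        refine MeasurableSet.iUnion fun i => MeasurableSet.iUnion fun hi =>
          hfilt ?_ _ (E.measurableSet_failure j (P.ℓ * b + i))
        rw [Nat.mul_succ]; omega
    refine (measureReal_iUnion_fintype_le _).trans
      ((Finset.sum_le_sum fun j _ => hblock j).trans ?_)
    simp
  have hcover : ∀ᵐ ω ∂μ, ω ∈ (Set.univ : Set Ω) →
      ω ∈ E.consensusBy u ∪ (A₀ ∪ (A₁ ∪ (A₂ ∪ A₃))) := by
    filter_upwards [E.ae_threshold_mem hP.β_lt] with ω hω _
    by_contra hcon
    simp only [Set.mem_union, not_or] at hcon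
    obtain ⟨hcon, hn₀, hn₁, hn₂, hn₃⟩ := hcon
    refine hcon (Steady.mem_consensusBy ⟨hω, fun m h1 h2 hm => ?_⟩ hP ?_ (fun j hj => ?_)
      fun j => ?_)
    · exact hn₁ (Set.mem_biUnion (Finset.mem_Ico.2 ⟨h1, h2⟩) hm)
    · simp only [hA₀, undecided, Set.mem_ofPred_eq, not_forall, not_not] at hn₀
      obtain ⟨i, hi, hv⟩ := hn₀
      exact ⟨s + i + 1, by omega, by omega, hv⟩
    · exact hn₂ (Set.mem_iUnion.2 ⟨j, hj⟩)
    · by_contra! hb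
      exact hn₃ (Set.mem_iUnion.2 ⟨j, hb⟩)
  have htot : (1 : ℝ) ≤ μ.real (E.consensusBy u) +
      (μ.real A₀ + (μ.real A₁ + (μ.real A₂ + μ.real A₃))) := by
    rw [← probReal_univ (μ := μ)]
    refine (ENNReal.toReal_mono (measure_ne_top _ _) (measure_mono_ae hcover)).trans ?_
    refine (measureReal_union_le _ _).trans (add_le_add_right ?_ _)
    refine (measureReal_union_le _ _).trans (add_le_add_right ?_ _)
    refine (measureReal_union_le _ _).trans (add_le_add_right ?_ _)
    exact measureReal_union_le _ _
  have hW : P.W u = P.honest * ((1 - (1 - P.err) ^ P.ℓ) ^ u + (P.err / (1 - P.err)) ^ (P.ℓ - 1)) +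
      (P.m₀ + P.ℓ * u) * Real.exp (-2 * (1 - P.q) * P.n * P.phi ^ 2) := by
    rw [W, hP.honest_eq]
  rw [hW]
  linarith

end Execution

end

theorem theorem1 {Ω : Type*} [MeasurableSpace Ω] (μ : Measure Ω) [IsProbabilityMeasure μ]
    (P : Params) (hhonest : 0 < P.honest) (hm₀ : 1 ≤ P.m₀) (hℓ : 1 ≤ P.ℓ)
    (ha : 1 / 2 < P.a) (hab : P.a ≤ P.b) (hb : P.b < 1)
    (hq : P.q < P.β) (hβ : P.β < 1 / 2) (hphi : 0 < P.phi)
    (u : ℕ) (E : Execution P μ) :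
    (E.IsCautious →
      1 - P.W u - P.psiCau ^ (P.m₀ - 1) ≤ μ.real (E.consensusBy u)) ∧
    (1 - P.W u - P.psiBer ^ (P.m₀ - 1) ≤ μ.real (E.consensusBy u)) ∧
    (1 - 2 * P.β ≤ P.b - P.a →
      (E.IsCautious → 1 - P.W u - P.psiCau ^ P.m₀ ≤ μ.real (E.consensusBy u)) ∧
      1 - P.W u - P.psiBer ^ P.m₀ ≤ μ.real (E.consensusBy u)) := by
  have hP : P.Admissible := ⟨hhonest, hℓ, hq, hβ, hphi⟩
  have h1 : 0 ≤ 1 - 2 * P.β := by linarith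
  have hcau : 0 ≤ P.psiCau := by
    have := mul_nonneg (inv_nonneg.2 h1) P.width_nonneg
    unfold Params.psiCau
    positivity
  have hber : 0 ≤ P.psiBer := by
    have := div_nonneg (add_nonneg P.q_nonneg P.width_nonneg) h1
    unfold Params.psiBer
    positivity
  have hlater : ∀ m, 1 ≤ m → 1 - 2 * P.β ≤ P.upper (m + 1) - P.lower (m + 1) := fun m hm => by
    simp only [Params.upper, Params.lower, show m + 1 ≠ 1 by omega, if_false]
    linarith
  have hall : 1 - 2 * P.β ≤ P.b - P.a → ∀ m, 1 - 2 * P.β ≤ P.upper (m + 1) - P.lower (m + 1) := by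
    intro h m
    rcases m with _ | m
    · simpa [Params.upper, Params.lower] using h
    · exact hlater (m + 1) (by omega)
  exact ⟨fun hE => E.le_measureReal_consensusBy hP u 1 hcau fun m h1 h2 =>
      E.condProbLE_undecided_cautious hP hE h2 (hlater m h1),
    E.le_measureReal_consensusBy hP u 1 hber fun m h1 h2 =>
      E.condProbLE_undecided_berserk hP h2 (hlater m h1),
    fun h => ⟨fun hE => E.le_measureReal_consensusBy hP u 0 hcau fun m _ h2 =>
      E.condProbLE_undecided_cautious hP hE h2 (hall h m),
    E.le_measureReal_consensusBy hP u 0 hber fun m _ h2 =>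
      E.condProbLE_undecided_berserk hP h2 (hall h m)⟩⟩
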